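/- Let $n\ge 0$, let $\eta_1,\dots,\eta_n\in\mathbb T=\{|z|=1\}$, let $q_1,\dots,q_n\in[0,\infty)$, and put $$R(z)=\prod_{j=1}^n (z-\eta_j)^{q_j},\qquad |R(z)|=\prod_{j=1}^n|z-\eta_j|^{q_j},\qquad \gamma(z)=\sum_{j=1}^n |q_j|\,|z-\eta_j|^{-1}$$ for $z$ in the open unit disc $\mathbb D$. For $f$ holomorphic in $\mathbb D$ and $0<\delta<1$ let $$\|f\|_{\mathcal N_{|R|^2,0}}=\|f\|_{\delta}:=\sup_{1-\delta<s<1}\int_0^{2\pi}|R(se^{i\theta})|^2\log^+|f(se^{i\theta})|\,d\theta+\sup_{1-\delta<s<1}\int_{\mathbb D}\gamma(sz)|R(sz)|^2\log^+|f(sz)|\,dm(z)\in[0,\infty],$$ where $m$ is the area (Lebesgue) measure, and let $\mathcal N_{|R|^2,0}(\mathbb D)$ be the class of all $f$ holomorphic in $\mathbb D$ with $\|f\|_\delta<\infty$ for some $0<\delta<1$. Then there is a constant $0<c(R)<\infty$, depending only on $R$ (not on $f$ or $\delta$), such that for every $f\in\mathcal N_{|R|^2,0}(\mathbb D)$ with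 $|f(0)|=1$ and every $0<\delta<1$ $$\sum_{a\in Z(f)}(1-|a|^2)\,|R(a)|^2\le c(R)\,\|f\|_{\delta},$$ where $Z(f)$ denotes the zeros of $f$ in $\mathbb D$, counted with multiplicity. -/

import Mathlib

open Set MeasureTheory
open scoped NNReal ENNReal

/-- The modulus `|R(z)| = ∏ j, |z - η j| ^ q j` of `R(z) = ∏ j, (z - η j) ^ q j`. For `z` different
from all the `η j` it does not depend on the choice of the branches of the powers. -/
noncomputable def absR {n : ℕ} (η : Fin n → ℂ) (q : Fin n → ℝ) (z : ℂ) : ℝ :=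
  ∏ j, ‖z - η j‖ ^ q j

/-- `absR` is the modulus of the product of complex powers (principal branches). -/
theorem norm_prod_cpow_eq_absR {n : ℕ} (η : Fin n → ℂ) (q : Fin n → ℝ) (z : ℂ) :
    ‖∏ j, (z - η j) ^ (q j : ℂ)‖ = absR η q z := by
  simp only [absR, norm_prod, Complex.norm_cpow_real]

/-- The function `γ(z) = ∑ j, |q j| |z - η j|⁻¹`. -/
noncomputable def gammaWeight {n : ℕ} (η : Fin n → ℂ) (q : Fin n → ℝ) (z : ℂ) : ℝ :=
  ∑ j, |q j| * ‖z - η j‖⁻¹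

/-- The quantity `‖f‖` of the generalised Nevanlinna class with weight `|R|²` and `p = 0`, for the
parameter `δ`: the supremum over `1 - δ < s < 1` of the integrals
`∫ |R(s e^{iθ})|² log⁺ |f(s e^{iθ})| dθ` over the circle, plus the supremum over `1 - δ < s < 1` of
the area integrals `∫ γ(sz) |R(sz)|² log⁺ |f(sz)|` over the unit disc. The integrands are
nonnegative, so the value is taken in `[0, ∞]`. -/
noncomputable def nevanlinnaNorm {n : ℕ} (η : Fin n → ℂ) (q : Fin n → ℝ) (δ : ℝ) (f : ℂ → ℂ) :
    ℝ≥0∞ :=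
  (⨆ s ∈ Ioo (1 - δ) 1, ∫⁻ θ in Ioc (0 : ℝ) (2 * Real.pi),
      ENNReal.ofReal (absR η q (s * Complex.exp (θ * Complex.I)) ^ 2 *
        Real.posLog ‖f (s * Complex.exp (θ * Complex.I))‖)) +
  (⨆ s ∈ Ioo (1 - δ) 1, ∫⁻ z in Metric.ball (0 : ℂ) 1,
      ENNReal.ofReal (gammaWeight η q (s * z) * absR η q (s * z) ^ 2 *
        Real.posLog ‖f (s * z)‖))

/-- The generalised Nevanlinna class of the unit disc with weight `|R|²` and `p = 0`: the functions
holomorphic in the open unit disc such that the quantity above is finite for some `0 < δ < 1`. -/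
def nevanlinnaClass {n : ℕ} (η : Fin n → ℂ) (q : Fin n → ℝ) : Set (ℂ → ℂ) :=
  {f | DifferentiableOn ℂ f (Metric.ball 0 1) ∧ ∃ δ ∈ Ioo (0 : ℝ) 1, nevanlinnaNorm η q δ f < ∞}

/-- The set `Z(f)` of the zeros of `f` in the open unit disc (without multiplicities). -/
def discZeros (f : ℂ → ℂ) : Set ℂ :=
  {a | a ∈ Metric.ball (0 : ℂ) 1 ∧ f a = 0}

/-- The sum `∑ (1 - |a|²) |R(a)|²` over the zeros `a` of `f` in the unit disc, each counted with its
multiplicity. -/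
noncomputable def blaschkeSum {n : ℕ} (η : Fin n → ℂ) (q : Fin n → ℝ) (f : ℂ → ℂ) : ℝ≥0∞ :=
  ∑' a : discZeros f, (analyticOrderNatAt f a : ℝ≥0∞) *
    ENNReal.ofReal ((1 - ‖(a : ℂ)‖ ^ 2) * absR η q a ^ 2)

/-! Write Q for the sum of the `q j`. The proof is a weighted Jensen formula, obtained by applying
Green's formula on an annulus about 0 to U = ½ log(|f|² + ε) and a test function φ. The test
function vanishes on |z| = s, is bounded below by a constant times (s - |z|)|R|², has a logarithmic
pole at 0, and satisfies 0 ≤ Δφ ≤ C γ|R|² away from 0. Since Δφ ≥ 0, U may be replaced in ∫ U Δφ by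
its majorant log⁺|f| + ½ log(1 + ε). The small circle about 0 contributes with a favourable sign,
because U(0) = ½ log(1 + ε) > 0. Thus ∫ φ ΔU is controlled by the circle and area integrals at
radius s. As ε → 0 the measures ΔU put mass at least 2π times the multiplicity on each zero, and s →
1 then gives the claim.

The test function is φ = h(|z|) W with W = exp(2 Re L), L = `logWeight`. The linear terms in L keep
W comparable to |R|² and make L'(0) = 0, so that zL' is of size |z|²γ and dividing by |z|² is
harmless at 0. For h = log(s/r) the expression |z|²Δφ would contain -4 Re(zL') W, which may be
negative. As the `q j` are nonnegative, Re(zL') ≤ 2Q|z|², and choosing r h' = -exp(-4Qr²) instead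
adds precisely the term that compensates for this. In the upper bound the dangerous term is h|zL'|²,
quadratic in γ; it is tamed by r h ≤ 1 - r and (1 - r)γ ≤ Q.

The carrying lemmas are `testLaplacian_nonneg`, `testLaplacian_le`,
`integral_testFunction_mul_regLaplacian`, `eventually_flux_nonneg` and
`sum_zeros_le_of_lintegral_regLaplacian_le`. -/

/-- The Euler derivative `z g'(z)`. -/
noncomputable def eulerDeriv (g : ℂ → ℂ) (z : ℂ) : ℂ := z * deriv g z

theorem DifferentiableOn.eulerDeriv {g : ℂ → ℂ} {s : Set ℂ} (hs : IsOpen s)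
    (hg : DifferentiableOn ℂ g s) : DifferentiableOn ℂ (eulerDeriv g) s :=
  differentiableOn_id.mul (hg.deriv hs)

/-! ### The holomorphic weight and the Laplacian of the test function -/

section Weight

variable {n : ℕ} (η : Fin n → ℂ) (q : Fin n → ℝ)

/-- A holomorphic function with `exp (2 * Re)` comparable to `|R|²` and with vanishing derivative
at the origin. -/
noncomputable def logWeight (z : ℂ) : ℂ :=
  ∑ j, (q j : ℂ) * (Complex.log (1 - starRingEnd ℂ (η j) * z) + starRingEnd ℂ (η j) * z)

/-- The weight `exp (2 * Re (logWeight))`. -/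
noncomputable def expWeight (z : ℂ) : ℝ := Real.exp (2 * (logWeight η q z).re)

theorem expWeight_pos (z : ℂ) : 0 < expWeight η q z := Real.exp_pos _

variable {η q}

theorem norm_conj_mul_eq (hη : ∀ j, ‖η j‖ = 1) (j : Fin n) (z : ℂ) :
    ‖starRingEnd ℂ (η j) * z‖ = ‖z‖ := by
  rw [norm_mul, RCLike.norm_conj, hη, one_mul]

theorem norm_one_sub_conj_mul (hη : ∀ j, ‖η j‖ = 1) (j : Fin n) (z : ℂ) :
    ‖1 - starRingEnd ℂ (η j) * z‖ = ‖z - η j‖ := by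
  have h : 1 - starRingEnd ℂ (η j) * z = -(starRingEnd ℂ (η j) * (z - η j)) := by
    have : starRingEnd ℂ (η j) * η j = 1 := by
      rw [mul_comm, Complex.mul_conj, Complex.normSq_eq_norm_sq, hη]; simp
    linear_combination -this
  rw [h, norm_neg, norm_conj_mul_eq hη]

theorem one_sub_norm_le (hη : ∀ j, ‖η j‖ = 1) (j : Fin n) (z : ℂ) : 1 - ‖z‖ ≤ ‖z - η j‖ := by
  have := norm_sub_norm_le (η j) z
  rwa [hη, norm_sub_rev] at this

theorem norm_sub_pos (hη : ∀ j, ‖η j‖ = 1) (j : Fin n) {z : ℂ} (hz : z ∈ Metric.ball (0 : ℂ) 1) :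
    0 < ‖z - η j‖ := by
  have := one_sub_norm_le hη j z
  rw [mem_ball_zero_iff] at hz
  linarith

theorem one_sub_conj_mul_mem_slitPlane (hη : ∀ j, ‖η j‖ = 1) (j : Fin n) {z : ℂ}
    (hz : z ∈ Metric.ball (0 : ℂ) 1) : 1 - starRingEnd ℂ (η j) * z ∈ Complex.slitPlane := by
  rw [sub_eq_add_neg]
  apply Complex.mem_slitPlane_of_norm_lt_one
  rw [norm_neg, norm_conj_mul_eq hη]
  exact mem_ball_zero_iff.1 hz

theorem hasDerivAt_logWeight (hη : ∀ j, ‖η j‖ = 1) {z : ℂ} (hz : z ∈ Metric.ball (0 : ℂ) 1) :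
    HasDerivAt (logWeight η q)
      (-∑ j, (q j : ℂ) * ((starRingEnd ℂ (η j)) ^ 2 * z / (1 - starRingEnd ℂ (η j) * z))) z := by
  rw [← Finset.sum_neg_distrib]
  refine HasDerivAt.fun_sum fun j _ => ?_
  have hs := one_sub_conj_mul_mem_slitPlane hη j hz
  have h1 : HasDerivAt (fun z => starRingEnd ℂ (η j) * z) (starRingEnd ℂ (η j)) z := by
    simpa using (hasDerivAt_id z).const_mul (starRingEnd ℂ (η j))
  refine ((((h1.const_sub 1).clog hs).add h1).const_mul (q j : ℂ)).congr_deriv ?_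
  have h0 := Complex.slitPlane_ne_zero hs
  field_simp
  ring

theorem differentiableOn_logWeight (hη : ∀ j, ‖η j‖ = 1) :
    DifferentiableOn ℂ (logWeight η q) (Metric.ball 0 1) := fun _ hz =>
  (hasDerivAt_logWeight hη hz).differentiableAt.differentiableWithinAt

theorem eulerDeriv_logWeight (hη : ∀ j, ‖η j‖ = 1) {z : ℂ} (hz : z ∈ Metric.ball (0 : ℂ) 1) :
    eulerDeriv (logWeight η q) z =
      ∑ j, (q j : ℂ) *
        -((starRingEnd ℂ (η j) * z) ^ 2 / (1 - starRingEnd ℂ (η j) * z)) := by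
  rw [eulerDeriv, (hasDerivAt_logWeight hη hz).deriv, mul_neg, Finset.mul_sum,
    ← Finset.sum_neg_distrib]
  exact Finset.sum_congr rfl fun j _ => by ring

theorem gammaWeight_nonneg (z : ℂ) : 0 ≤ gammaWeight η q z :=
  Finset.sum_nonneg fun _ _ => by positivity

/-- The linear terms in `logWeight` produce the factor |z|², which cancels the |z|⁻² in front of the
Laplacian in polar coordinates. -/
theorem norm_eulerDeriv_logWeight_le (hη : ∀ j, ‖η j‖ = 1) {z : ℂ}
    (hz : z ∈ Metric.ball (0 : ℂ) 1) :
    ‖eulerDeriv (logWeight η q) z‖ ≤ ‖z‖ ^ 2 * gammaWeight η q z := by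
  rw [eulerDeriv_logWeight hη hz, gammaWeight, Finset.mul_sum]
  refine norm_sum_le_of_le _ fun j _ => le_of_eq ?_
  rw [norm_mul, norm_neg, norm_div, norm_pow, norm_conj_mul_eq hη, norm_one_sub_conj_mul hη,
    Complex.norm_real, Real.norm_eq_abs, div_eq_mul_inv]
  ring

/-- The quotient blows up at v = 1, but -v²/(1 - v) = 1 + v - 1/(1 - v) and Re(1/(1 - v)) ≥ ½ on the
disc, so only a bound from above can hold. The factor |v|² needs the explicit computation. -/
theorem re_neg_sq_div_one_sub_le {v : ℂ} (hv : ‖v‖ < 1) : (-(v ^ 2 / (1 - v))).re ≤ 2 * ‖v‖ ^ 2 := by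
  obtain ⟨x, y⟩ := v
  have hn : ‖(⟨x, y⟩ : ℂ)‖ ^ 2 = x ^ 2 + y ^ 2 := by
    rw [← Complex.normSq_eq_norm_sq, Complex.normSq_mk]; ring
  have h1 : x ^ 2 + y ^ 2 < 1 := by
    rw [← hn]; nlinarith [norm_nonneg (⟨x, y⟩ : ℂ)]
  have hx : x < 1 := by nlinarith
  have hx' : -1 < x := by nlinarith
  have hd : 0 < (1 - x) ^ 2 + y ^ 2 := by nlinarith [sq_pos_of_pos (sub_pos.2 hx), sq_nonneg y]
  have he : (-((⟨x, y⟩ : ℂ) ^ 2 / (1 - (⟨x, y⟩ : ℂ)))).re =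
      (-(x ^ 2 * (1 - x)) + y ^ 2 * (1 + x)) / ((1 - x) ^ 2 + y ^ 2) := by
    rw [Complex.neg_re, Complex.div_re, Complex.normSq_apply]
    simp [pow_two]
    have : (1 - x) * (1 - x) + y * y ≠ 0 := by nlinarith
    field_simp
    ring
  rw [he, hn, div_le_iff₀ hd]
  -- Here y is the imaginary part of v · conj(1 - v), whose real part is x(1 - x) - y².
  have hy : y ^ 2 ≤ (x ^ 2 + y ^ 2) * ((1 - x) ^ 2 + y ^ 2) := by
    nlinarith [sq_nonneg (x * (1 - x) - y ^ 2)]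
  nlinarith [mul_nonneg (sq_nonneg x) (sub_nonneg.2 hx.le), mul_nonneg (sq_nonneg y) (sub_nonneg.2 hx.le)]

theorem re_eulerDeriv_logWeight_le (hη : ∀ j, ‖η j‖ = 1) (hq : ∀ j, 0 ≤ q j) {z : ℂ}
    (hz : z ∈ Metric.ball (0 : ℂ) 1) :
    (eulerDeriv (logWeight η q) z).re ≤ 2 * (∑ j, q j) * ‖z‖ ^ 2 := by
  rw [eulerDeriv_logWeight hη hz, Complex.re_sum, Finset.mul_sum, Finset.sum_mul]
  refine Finset.sum_le_sum fun j _ => ?_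
  rw [Complex.re_ofReal_mul]
  have h := re_neg_sq_div_one_sub_le (v := starRingEnd ℂ (η j) * z)
    (by rw [norm_conj_mul_eq hη]; exact mem_ball_zero_iff.1 hz)
  rw [norm_conj_mul_eq hη] at h
  calc q j * _ ≤ q j * (2 * ‖z‖ ^ 2) := mul_le_mul_of_nonneg_left h (hq j)
    _ = _ := by ring

theorem sum_le_two_mul_gammaWeight (hη : ∀ j, ‖η j‖ = 1) {z : ℂ}
    (hz : z ∈ Metric.ball (0 : ℂ) 1) : ∑ j, q j ≤ 2 * gammaWeight η q z := by
  rw [gammaWeight, Finset.mul_sum]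
  refine Finset.sum_le_sum fun j _ => ?_
  have h0 := norm_sub_pos hη j hz
  have h2 : ‖z - η j‖ ≤ 2 := by
    have := norm_sub_le z (η j)
    rw [hη] at this
    linarith [mem_ball_zero_iff.1 hz]
  have : 1 ≤ 2 * ‖z - η j‖⁻¹ := by
    rw [← div_eq_mul_inv, le_div_iff₀ h0]; linarith
  calc q j ≤ |q j| * 1 := by rw [mul_one]; exact le_abs_self _
    _ ≤ |q j| * (2 * ‖z - η j‖⁻¹) := mul_le_mul_of_nonneg_left this (abs_nonneg _)
    _ = _ := by ring

/-- Each singularity lies on the unit circle, at distance at least 1 - |z|. The estimate absorbs one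
of the two factors γ in |zL'|². -/
theorem one_sub_mul_gammaWeight_le (hη : ∀ j, ‖η j‖ = 1) (hq : ∀ j, 0 ≤ q j) {z : ℂ}
    (hz : z ∈ Metric.ball (0 : ℂ) 1) : (1 - ‖z‖) * gammaWeight η q z ≤ ∑ j, q j := by
  rw [gammaWeight, Finset.mul_sum]
  refine Finset.sum_le_sum fun j _ => ?_
  have h0 := norm_sub_pos hη j hz
  rw [abs_of_nonneg (hq j)]
  calc (1 - ‖z‖) * (q j * ‖z - η j‖⁻¹) ≤ ‖z - η j‖ * (q j * ‖z - η j‖⁻¹) :=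
        mul_le_mul_of_nonneg_right (one_sub_norm_le hη j z)
          (mul_nonneg (hq j) (inv_nonneg.2 h0.le))
    _ = q j := by field_simp

theorem expWeight_eq (hη : ∀ j, ‖η j‖ = 1) {z : ℂ} (hz : z ∈ Metric.ball (0 : ℂ) 1) :
    expWeight η q z =
      absR η q z ^ 2 * Real.exp (2 * ∑ j, q j * (starRingEnd ℂ (η j) * z).re) := by
  have h : absR η q z = Real.exp (∑ j, q j * Real.log ‖z - η j‖) := by
    rw [absR, Real.exp_sum]
    refine Finset.prod_congr rfl fun j _ => ?_
    rw [Real.rpow_def_of_pos (norm_sub_pos hη j hz), mul_comm]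
  rw [expWeight, h, ← Real.exp_nat_mul, ← Real.exp_add, logWeight, Complex.re_sum]
  congr 1
  push_cast
  rw [← mul_add, ← Finset.sum_add_distrib]
  congr 1
  refine Finset.sum_congr rfl fun j _ => ?_
  rw [Complex.re_ofReal_mul, Complex.add_re, Complex.log_re, norm_one_sub_conj_mul hη]
  ring

theorem abs_sum_mul_re_le (hη : ∀ j, ‖η j‖ = 1) (hq : ∀ j, 0 ≤ q j) {z : ℂ}
    (hz : z ∈ Metric.ball (0 : ℂ) 1) :
    |∑ j, q j * (starRingEnd ℂ (η j) * z).re| ≤ ∑ j, q j := by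
  refine (Finset.abs_sum_le_sum_abs _ _).trans (Finset.sum_le_sum fun j _ => ?_)
  rw [abs_mul, abs_of_nonneg (hq j)]
  refine mul_le_of_le_one_right (hq j) ((Complex.abs_re_le_norm _).trans ?_)
  rw [norm_conj_mul_eq hη]
  exact (mem_ball_zero_iff.1 hz).le

theorem expWeight_le (hη : ∀ j, ‖η j‖ = 1) (hq : ∀ j, 0 ≤ q j) {z : ℂ}
    (hz : z ∈ Metric.ball (0 : ℂ) 1) :
    expWeight η q z ≤ Real.exp (2 * ∑ j, q j) * absR η q z ^ 2 := by
  rw [expWeight_eq hη hz, mul_comm]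
  refine mul_le_mul_of_nonneg_right (Real.exp_le_exp.2 ?_) (sq_nonneg _)
  linarith [(abs_le.1 (abs_sum_mul_re_le hη hq hz)).2]

theorem absR_sq_le (hη : ∀ j, ‖η j‖ = 1) (hq : ∀ j, 0 ≤ q j) {z : ℂ}
    (hz : z ∈ Metric.ball (0 : ℂ) 1) :
    absR η q z ^ 2 ≤ Real.exp (2 * ∑ j, q j) * expWeight η q z := by
  rw [expWeight_eq hη hz, mul_left_comm, ← Real.exp_add]
  refine le_mul_of_one_le_right (sq_nonneg _) (Real.one_le_exp ?_)
  linarith [(abs_le.1 (abs_sum_mul_re_le hη hq hz)).1]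

/-- The expression which will turn out to be `r²` times the Laplacian of `h(|z|) * expWeight z`,
where `-r h'(r) = e = exp (-4 Q r²)`. -/
noncomputable def testLaplacian (η : Fin n → ℂ) (q : Fin n → ℝ) (e h : ℝ) (z : ℂ) : ℝ :=
  expWeight η q z * (8 * (∑ j, q j) * ‖z‖ ^ 2 * e - 4 * e * (eulerDeriv (logWeight η q) z).re
    + 4 * h * ‖eulerDeriv (logWeight η q) z‖ ^ 2)

/-- The summand with 8Q|z|² is 4e times the upper bound 2Q|z|² for the real part of the Euler
derivative, so it outweighs the only term of variable sign. -/
theorem testLaplacian_nonneg (hη : ∀ j, ‖η j‖ = 1) (hq : ∀ j, 0 ≤ q j) {z : ℂ}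
    (hz : z ∈ Metric.ball (0 : ℂ) 1) {e h : ℝ} (he : 0 ≤ e) (hh : 0 ≤ h) :
    0 ≤ testLaplacian η q e h z := by
  refine mul_nonneg (expWeight_pos η q z).le (add_nonneg ?_ (by positivity))
  have := mul_le_mul_of_nonneg_left (re_eulerDeriv_logWeight_le hη hq hz) he
  linarith

/-- The three summands contribute 16, 4 and 4Q to the constant. -/
theorem testLaplacian_le (hη : ∀ j, ‖η j‖ = 1) (hq : ∀ j, 0 ≤ q j) {z : ℂ}
    (hz : z ∈ Metric.ball (0 : ℂ) 1) {e h : ℝ} (he : 0 ≤ e) (he1 : e ≤ 1) (hh : 0 ≤ h)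
    (hh1 : ‖z‖ * h ≤ 1 - ‖z‖) :
    testLaplacian η q e h z ≤
      (20 + 4 * ∑ j, q j) * expWeight η q z * (‖z‖ ^ 2 * gammaWeight η q z) := by
  set Q := ∑ j, q j with hQ
  set γ := gammaWeight η q z
  set d := eulerDeriv (logWeight η q) z
  set r := ‖z‖
  have hr : 0 ≤ r := norm_nonneg z
  have hr1 : r ≤ 1 := (mem_ball_zero_iff.1 hz).le
  have hγ : 0 ≤ γ := gammaWeight_nonneg z
  have hQ0 : 0 ≤ Q := Finset.sum_nonneg fun j _ => hq j
  have hd : ‖d‖ ≤ r ^ 2 * γ := norm_eulerDeriv_logWeight_le hη hz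
  have hre : -d.re ≤ ‖d‖ := (neg_le_abs _).trans (Complex.abs_re_le_norm d)
  have hQγ : Q ≤ 2 * γ := sum_le_two_mul_gammaWeight hη hz
  have hγQ : (1 - r) * γ ≤ Q := one_sub_mul_gammaWeight_le hη hq hz
  have h1 : 8 * Q * r ^ 2 * e ≤ 16 * (r ^ 2 * γ) := by
    calc 8 * Q * r ^ 2 * e ≤ 8 * Q * r ^ 2 * 1 := by gcongr
      _ ≤ 8 * (2 * γ) * r ^ 2 * 1 := by gcongr
      _ = _ := by ring
  have h2 : -(4 * e * d.re) ≤ 4 * (r ^ 2 * γ) := by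
    calc -(4 * e * d.re) = 4 * e * -d.re := by ring
      _ ≤ 4 * e * ‖d‖ := by gcongr
      _ ≤ 4 * 1 * (r ^ 2 * γ) := by gcongr
      _ = _ := by ring
  -- One factor γ is spent: r h ≤ 1 - r, and (1 - r)γ ≤ Q.
  have h3 : 4 * h * ‖d‖ ^ 2 ≤ 4 * Q * (r ^ 2 * γ) := by
    calc 4 * h * ‖d‖ ^ 2 ≤ 4 * h * (r ^ 2 * γ) ^ 2 := by gcongr
      _ = 4 * ((r * h) * γ) * r * (r ^ 2 * γ) := by ring
      _ ≤ 4 * ((1 - r) * γ) * 1 * (r ^ 2 * γ) := by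
        have : 0 ≤ 1 - r := by linarith
        gcongr
      _ ≤ 4 * Q * 1 * (r ^ 2 * γ) := by gcongr
      _ = _ := by ring
  calc testLaplacian η q e h z ≤ expWeight η q z * ((20 + 4 * Q) * (r ^ 2 * γ)) :=
        mul_le_mul_of_nonneg_left (by linarith) (expWeight_pos η q z).le
    _ = _ := by ring

end Weight

/-! ### Derivatives along rays and circles, and the flux -/

section Curve

theorem HasDerivAt.complex_re {F : ℝ → ℂ} {F' : ℂ} {t : ℝ} (h : HasDerivAt F F' t) :
    HasDerivAt (fun t => (F t).re) F'.re t :=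
  Complex.reCLM.hasFDerivAt.comp_hasDerivAt t h

theorem HasDerivAt.complex_conj {F : ℝ → ℂ} {F' : ℂ} {t : ℝ} (h : HasDerivAt F F' t) :
    HasDerivAt (fun t => starRingEnd ℂ (F t)) (starRingEnd ℂ F') t :=
  Complex.conjCLE.toContinuousLinearMap.hasFDerivAt.comp_hasDerivAt t h

theorem HasDerivAt.complex_norm_sq {F : ℝ → ℂ} {F' : ℂ} {t : ℝ} (h : HasDerivAt F F' t) :
    HasDerivAt (fun t => ‖F t‖ ^ 2) (2 * (starRingEnd ℂ (F t) * F').re) t := by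
  have h1 := (h.complex_conj.mul h).complex_re
  have h2 : ∀ z : ℂ, (starRingEnd ℂ z * z).re = ‖z‖ ^ 2 := fun z => by
    rw [mul_comm, Complex.mul_conj, Complex.ofReal_re, Complex.normSq_eq_norm_sq]
  refine (h1.congr_of_eventuallyEq (.of_forall fun t => (h2 (F t)).symm)).congr_deriv ?_
  simp
  ring

/-- `½ log (|f|² + ε)`. -/
noncomputable def regLog (f : ℂ → ℂ) (ε : ℝ) (z : ℂ) : ℝ := Real.log (‖f z‖ ^ 2 + ε) / 2

/-- First logarithmic derivative of `regLog f ε` in the direction `c`. -/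
noncomputable def regLogD (f : ℂ → ℂ) (ε : ℝ) (c z : ℂ) : ℝ :=
  (starRingEnd ℂ (f z) * (c * eulerDeriv f z)).re / (‖f z‖ ^ 2 + ε)

/-- Second logarithmic derivative of `regLog f ε` in the direction `c`. -/
noncomputable def regLogDD (f : ℂ → ℂ) (ε : ℝ) (c z : ℂ) : ℝ :=
  (‖c * eulerDeriv f z‖ ^ 2
    + (starRingEnd ℂ (f z) * (c ^ 2 * eulerDeriv (eulerDeriv f) z)).re) / (‖f z‖ ^ 2 + ε)
  - 2 * (starRingEnd ℂ (f z) * (c * eulerDeriv f z)).re ^ 2 / (‖f z‖ ^ 2 + ε) ^ 2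

variable {γ : ℝ → ℂ} {t ρ : ℝ} {c : ℂ} {f g : ℂ → ℂ} {ε : ℝ}

/-- Solutions of γ' = ρcγ include rays (c = 1, ρ = 1/r) and circles (c = i, ρ = 1), so a single
computation serves the radial and the angular direction. -/
theorem hasDerivAt_comp_curve (hγ : HasDerivAt γ (ρ * c * γ t) t)
    (ht : γ t ∈ Metric.ball (0 : ℂ) 1) (hg : DifferentiableOn ℂ g (Metric.ball 0 1)) :
    HasDerivAt (fun t => g (γ t)) (ρ * c * eulerDeriv g (γ t)) t := by
  have h := (hg.differentiableAt (Metric.isOpen_ball.mem_nhds ht)).hasDerivAt.comp t hγ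
  refine h.congr_deriv ?_
  rw [eulerDeriv]
  ring

theorem hasDerivAt_regLog (hε : 0 < ε) (hγ : HasDerivAt γ (ρ * c * γ t) t)
    (ht : γ t ∈ Metric.ball (0 : ℂ) 1) (hf : DifferentiableOn ℂ f (Metric.ball 0 1)) :
    HasDerivAt (fun t => regLog f ε (γ t)) (ρ * regLogD f ε c (γ t)) t := by
  have h0 : ‖f (γ t)‖ ^ 2 + ε ≠ 0 := by positivity
  refine ((((hasDerivAt_comp_curve hγ ht hf).complex_norm_sq.add_const ε).log h0).div_const
    2).congr_deriv ?_
  rw [regLogD]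
  have : (starRingEnd ℂ (f (γ t)) * (ρ * c * eulerDeriv f (γ t))).re =
      ρ * (starRingEnd ℂ (f (γ t)) * (c * eulerDeriv f (γ t))).re := by
    rw [← Complex.re_ofReal_mul]; congr 1; ring
  rw [this]
  ring

theorem hasDerivAt_regLogD (hε : 0 < ε) (hγ : HasDerivAt γ (ρ * c * γ t) t)
    (ht : γ t ∈ Metric.ball (0 : ℂ) 1) (hf : DifferentiableOn ℂ f (Metric.ball 0 1)) :
    HasDerivAt (fun t => regLogD f ε c (γ t)) (ρ * regLogDD f ε c (γ t)) t := by
  have h0 : ‖f (γ t)‖ ^ 2 + ε ≠ 0 := by positivity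
  have h1 := hasDerivAt_comp_curve hγ ht hf
  have h2 := hasDerivAt_comp_curve hγ ht (hf.eulerDeriv Metric.isOpen_ball)
  refine ((h1.complex_conj.mul (h2.const_mul c)).complex_re.fun_div
    (h1.complex_norm_sq.add_const ε) h0).congr_deriv ?_
  rw [regLogDD]
  have e1 : (starRingEnd ℂ (f (γ t)) * (ρ * c * eulerDeriv f (γ t))).re =
      ρ * (starRingEnd ℂ (f (γ t)) * (c * eulerDeriv f (γ t))).re := by
    rw [← Complex.re_ofReal_mul]; congr 1; ring
  have e2 : (starRingEnd ℂ (ρ * c * eulerDeriv f (γ t)) * (c * eulerDeriv f (γ t))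
      + starRingEnd ℂ (f (γ t)) * (c * (ρ * c * eulerDeriv (eulerDeriv f) (γ t)))).re =
      ρ * (‖c * eulerDeriv f (γ t)‖ ^ 2
        + (starRingEnd ℂ (f (γ t)) * (c ^ 2 * eulerDeriv (eulerDeriv f) (γ t))).re) := by
    rw [← Complex.normSq_eq_norm_sq,
      ← Complex.ofReal_re (Complex.normSq (c * eulerDeriv f (γ t))), ← Complex.add_re,
      ← Complex.re_ofReal_mul, Complex.normSq_eq_conj_mul_self]
    congr 1
    simp only [map_mul, Complex.conj_ofReal]
    ring
  simp only [Pi.mul_apply] at *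
  rw [e2, e1]
  field_simp

variable {n : ℕ} {η : Fin n → ℂ} {q : Fin n → ℝ}

theorem hasDerivAt_expWeight (hη : ∀ j, ‖η j‖ = 1) (hγ : HasDerivAt γ (ρ * c * γ t) t)
    (ht : γ t ∈ Metric.ball (0 : ℂ) 1) :
    HasDerivAt (fun t => expWeight η q (γ t))
      (ρ * (2 * (c * eulerDeriv (logWeight η q) (γ t)).re * expWeight η q (γ t))) t := by
  refine ((hasDerivAt_comp_curve hγ ht
    (differentiableOn_logWeight hη)).complex_re.const_mul 2).exp.congr_deriv ?_
  rw [mul_assoc, Complex.re_ofReal_mul, expWeight]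
  ring

theorem hasDerivAt_re_eulerDeriv_logWeight (hη : ∀ j, ‖η j‖ = 1)
    (hγ : HasDerivAt γ (ρ * c * γ t) t) (ht : γ t ∈ Metric.ball (0 : ℂ) 1) :
    HasDerivAt (fun t => (c * eulerDeriv (logWeight η q) (γ t)).re)
      (ρ * (c ^ 2 * eulerDeriv (eulerDeriv (logWeight η q)) (γ t)).re) t := by
  refine ((hasDerivAt_comp_curve hγ ht ((differentiableOn_logWeight hη).eulerDeriv
    Metric.isOpen_ball)).const_mul c).complex_re.congr_deriv ?_
  rw [← Complex.re_ofReal_mul]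
  congr 1
  ring

/-- The flux `φ ∂U - U ∂φ` in the direction `c` for `U = regLog f ε`, `φ = h * expWeight`;
here `h'` stands for the derivative of `h`. -/
noncomputable def flux (η : Fin n → ℂ) (q : Fin n → ℝ) (f : ℂ → ℂ) (ε h h' : ℝ) (c z : ℂ) : ℝ :=
  h * expWeight η q z * regLogD f ε c z - regLog f ε z *
    (h' * expWeight η q z + h * (2 * (c * eulerDeriv (logWeight η q) z).re * expWeight η q z))

/-- The derivative of the flux: `φ ∂²U - U ∂²φ`. -/
noncomputable def fluxD (η : Fin n → ℂ) (q : Fin n → ℝ) (f : ℂ → ℂ) (ε h h' h'' : ℝ)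
    (c z : ℂ) : ℝ :=
  h * expWeight η q z * regLogDD f ε c z - regLog f ε z * (expWeight η q z *
    (h'' + 4 * h' * (c * eulerDeriv (logWeight η q) z).re
      + h * (2 * (c ^ 2 * eulerDeriv (eulerDeriv (logWeight η q)) z).re
        + 4 * (c * eulerDeriv (logWeight η q) z).re ^ 2)))

theorem hasDerivAt_flux (hη : ∀ j, ‖η j‖ = 1) (hε : 0 < ε) (hγ : HasDerivAt γ (ρ * c * γ t) t)
    (ht : γ t ∈ Metric.ball (0 : ℂ) 1) (hf : DifferentiableOn ℂ f (Metric.ball 0 1))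
    {h h' : ℝ → ℝ} {h'' : ℝ} (hh : HasDerivAt h (ρ * h' t) t) (hh' : HasDerivAt h' (ρ * h'') t) :
    HasDerivAt (fun t => flux η q f ε (h t) (h' t) c (γ t))
      (ρ * fluxD η q f ε (h t) (h' t) h'' c (γ t)) t := by
  have hW := hasDerivAt_expWeight (q := q) hη hγ ht
  have hV := hasDerivAt_re_eulerDeriv_logWeight (q := q) hη hγ ht
  have hU := hasDerivAt_regLog hε hγ ht hf
  have hU' := hasDerivAt_regLogD hε hγ ht hf
  refine (((hh.mul hW).mul hU').fun_sub (hU.mul ((hh'.mul hW).fun_add (hh.mul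
    ((hV.const_mul 2).mul hW))))).congr_deriv ?_
  simp only [fluxD, Pi.mul_apply]
  ring

/-- Adding the second derivatives in the radial and the angular direction gives the Laplacians. -/
theorem fluxD_add_fluxD (hε : 0 < ε) {e h r : ℝ} {z : ℂ} (hr : ‖z‖ = r) :
    fluxD η q f ε h (-e) (8 * (∑ j, q j) * r ^ 2 * e) 1 z + fluxD η q f ε h 0 0 Complex.I z =
      h * expWeight η q z * (2 * ε * ‖eulerDeriv f z‖ ^ 2 / (‖f z‖ ^ 2 + ε) ^ 2)
        - regLog f ε z * testLaplacian η q e h z := by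
  have hU : regLogDD f ε 1 z + regLogDD f ε Complex.I z =
      2 * ε * ‖eulerDeriv f z‖ ^ 2 / (‖f z‖ ^ 2 + ε) ^ 2 := by
    have h0 : ‖f z‖ ^ 2 + ε ≠ 0 := by positivity
    simp only [regLogDD, one_mul, one_pow, Complex.I_sq, norm_mul, Complex.norm_I]
    generalize eulerDeriv (eulerDeriv f) z = b
    generalize eulerDeriv f z = a
    -- Multiplication by i exchanges real and imaginary part up to sign, so the two squares add up
    -- to |f|²|a|². The terms carrying c² cancel because 1 + i² = 0.
    have e1 : (starRingEnd ℂ (f z) * (Complex.I * a)).re ^ 2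
        = ‖f z‖ ^ 2 * ‖a‖ ^ 2 - (starRingEnd ℂ (f z) * a).re ^ 2 := by
      rw [← Complex.normSq_eq_norm_sq, ← Complex.normSq_eq_norm_sq, Complex.normSq_apply,
        Complex.normSq_apply]
      simp
      ring
    have e2 : (starRingEnd ℂ (f z) * (-1 * b)).re = -(starRingEnd ℂ (f z) * b).re := by simp
    rw [e1, e2]
    field_simp
    ring
  rw [← hU, testLaplacian, ← Complex.normSq_eq_norm_sq (eulerDeriv _ _), Complex.normSq_apply]
  simp only [fluxD, hr]
  simp
  ring

end Curve

/-! ### Green's formula and integration in polar coordinates -/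

section Polar

/-- The point with polar coordinates `r, θ`. -/
noncomputable def polarPoint (r θ : ℝ) : ℂ := r * Complex.exp (θ * Complex.I)

theorem norm_polarPoint {r : ℝ} (hr : 0 ≤ r) (θ : ℝ) : ‖polarPoint r θ‖ = r := by
  rw [polarPoint, norm_mul, Complex.norm_exp_ofReal_mul_I, mul_one, Complex.norm_real,
    Real.norm_of_nonneg hr]

theorem continuous_polarPoint : Continuous (Function.uncurry polarPoint) := by
  unfold polarPoint Function.uncurry
  fun_prop

theorem polarPoint_periodic (r : ℝ) : Function.Periodic (polarPoint r) (2 * Real.pi) := by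
  intro θ
  rw [polarPoint, polarPoint]
  push_cast
  rw [add_mul, Complex.exp_periodic]

theorem hasDerivAt_polarPoint_left {r : ℝ} (hr : r ≠ 0) (θ : ℝ) :
    HasDerivAt (fun r => polarPoint r θ) ((r⁻¹ : ℝ) * 1 * polarPoint r θ) r := by
  refine ((hasDerivAt_id r).ofReal_comp.mul_const (Complex.exp (θ * Complex.I))).congr_deriv ?_
  have : (r : ℂ) ≠ 0 := by exact_mod_cast hr
  rw [polarPoint]
  push_cast
  field_simp

theorem hasDerivAt_polarPoint_right (r θ : ℝ) :
    HasDerivAt (fun θ => polarPoint r θ) ((1 : ℝ) * Complex.I * polarPoint r θ) θ := by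
  refine ((((hasDerivAt_id θ).ofReal_comp.mul_const Complex.I).cexp).const_mul
    (r : ℂ)).congr_deriv ?_
  rw [polarPoint]
  simp
  ring

theorem integrableOn_prod_of_continuousOn {F : ℝ × ℝ → ℝ} {a b c d : ℝ}
    (hF : ContinuousOn F (Icc a b ×ˢ Icc c d)) :
    IntegrableOn F (Ioc a b ×ˢ Ioc c d) (volume.prod volume) :=
  (hF.integrableOn_compact (isCompact_Icc.prod isCompact_Icc)).mono_set
    (prod_mono Ioc_subset_Icc_self Ioc_subset_Icc_self)

theorem integral_integral_swap_of_continuousOn {F : ℝ → ℝ → ℝ} {a b c d : ℝ} (hab : a ≤ b)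
    (hcd : c ≤ d) (hF : ContinuousOn (Function.uncurry F) (Icc a b ×ˢ Icc c d)) :
    ∫ x in a..b, ∫ y in c..d, F x y = ∫ y in c..d, ∫ x in a..b, F x y := by
  simp only [intervalIntegral.integral_of_le hab, intervalIntegral.integral_of_le hcd]
  apply integral_integral_swap
  rw [Measure.prod_restrict]
  exact integrableOn_prod_of_continuousOn hF

/-- Green's formula on an annulus in polar coordinates, for a vector field with components
`P, S`. -/
theorem integral_divergence_polar {P P' S S' : ℝ → ℝ → ℝ} {a b : ℝ} (hab : a ≤ b)
    (hP : ∀ r ∈ Icc a b, ∀ θ, HasDerivAt (fun r => P r θ) (P' r θ) r)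
    (hS : ∀ r ∈ Icc a b, ∀ θ, HasDerivAt (fun θ => S r θ) (S' r θ) θ)
    (hper : ∀ r ∈ Icc a b, S r Real.pi = S r (-Real.pi))
    (hPc : ContinuousOn (Function.uncurry P) (Icc a b ×ˢ univ))
    (hPc' : ContinuousOn (Function.uncurry P') (Icc a b ×ˢ univ))
    (hSc' : ContinuousOn (Function.uncurry S') (Icc a b ×ˢ univ)) :
    ∫ r in a..b, ∫ θ in -Real.pi..Real.pi, (P' r θ + S' r θ) =
      (∫ θ in -Real.pi..Real.pi, P b θ) - ∫ θ in -Real.pi..Real.pi, P a θ := by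
  have hpi : -Real.pi ≤ Real.pi := by linarith [Real.pi_pos]
  have sec : ∀ {F : ℝ → ℝ → ℝ}, ContinuousOn (Function.uncurry F) (Icc a b ×ˢ univ) →
      ∀ r ∈ Icc a b, Continuous (F r) := fun {F} hF r hr =>
    continuousOn_univ.1 (hF.comp (f := fun θ => (r, θ)) (by fun_prop)
      fun θ _ => ⟨hr, mem_univ _⟩)
  have sec' : ∀ {F : ℝ → ℝ → ℝ}, ContinuousOn (Function.uncurry F) (Icc a b ×ˢ univ) →
      ∀ θ, ContinuousOn (fun r => F r θ) (Icc a b) := fun {F} hF θ =>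
    hF.comp (f := fun r => (r, θ)) (by fun_prop) fun r hr => ⟨hr, mem_univ _⟩
  -- By periodicity the angular derivative integrates to zero over a full turn.
  have h1 : ∫ r in a..b, ∫ θ in -Real.pi..Real.pi, (P' r θ + S' r θ) =
      ∫ r in a..b, ∫ θ in -Real.pi..Real.pi, P' r θ := by
    refine intervalIntegral.integral_congr fun r hr => ?_
    rw [uIcc_of_le hab] at hr
    have hi : IntervalIntegrable (S' r) volume (-Real.pi) Real.pi :=
      (sec hSc' r hr).intervalIntegrable _ _
    rw [intervalIntegral.integral_add ((sec hPc' r hr).intervalIntegrable _ _) hi,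
      intervalIntegral.integral_eq_sub_of_hasDerivAt (fun θ _ => hS r hr θ) hi, hper r hr,
      sub_self, add_zero]
  rw [h1, integral_integral_swap_of_continuousOn hab hpi
    (hPc'.mono (prod_mono Subset.rfl (subset_univ _))),
    ← intervalIntegral.integral_sub
      ((sec hPc b (right_mem_Icc.2 hab)).intervalIntegrable _ _)
      ((sec hPc a (left_mem_Icc.2 hab)).intervalIntegrable _ _)]
  refine intervalIntegral.integral_congr fun θ _ => ?_
  refine intervalIntegral.integral_eq_sub_of_hasDerivAt (f := fun r => P r θ)
    (fun r hr => hP r (by rwa [uIcc_of_le hab] at hr) θ) ?_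
  exact ContinuousOn.intervalIntegrable (by rw [uIcc_of_le hab]; exact sec' hPc' θ)

theorem continuousOn_comp_polarPoint {g : ℂ → ℝ} {a b : ℝ} (ha : 0 ≤ a)
    (hg : ContinuousOn g {z | ‖z‖ ∈ Icc a b}) :
    ContinuousOn (fun p : ℝ × ℝ => g (polarPoint p.1 p.2)) (Icc a b ×ˢ univ) :=
  hg.comp continuous_polarPoint.continuousOn fun p hp => by
    rw [mem_ofPred_eq]
    exact (norm_polarPoint (ha.trans hp.1.1) p.2).symm ▸ hp.1

theorem integral_integral_eq_setIntegral_prod {F : ℝ × ℝ → ℝ} {a b : ℝ} (hab : a ≤ b)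
    (hF : ContinuousOn F (Icc a b ×ˢ univ)) :
    IntegrableOn F (Ioc a b ×ˢ Ioc (-Real.pi) Real.pi) ∧
    ∫ r in a..b, ∫ θ in -Real.pi..Real.pi, F (r, θ) =
      ∫ p in Ioc a b ×ˢ Ioc (-Real.pi) Real.pi, F p := by
  have hpi : -Real.pi ≤ Real.pi := by linarith [Real.pi_pos]
  have hi : IntegrableOn F (Ioc a b ×ˢ Ioc (-Real.pi) Real.pi) :=
    integrableOn_prod_of_continuousOn (hF.mono (prod_mono Subset.rfl (subset_univ _)))
  refine ⟨hi, ?_⟩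
  simp only [intervalIntegral.integral_of_le hab, intervalIntegral.integral_of_le hpi]
  exact (setIntegral_prod _ hi).symm

theorem ofReal_integral_polar {g : ℂ → ℝ} {a b : ℝ} (ha : 0 < a) (hab : a ≤ b)
    (hg : ContinuousOn g {z | ‖z‖ ∈ Icc a b}) (hg0 : ∀ z, ‖z‖ ∈ Icc a b → 0 ≤ g z) :
    ENNReal.ofReal (∫ r in a..b, ∫ θ in -Real.pi..Real.pi, r * g (polarPoint r θ)) =
      ∫⁻ z in {z : ℂ | ‖z‖ ∈ Ioo a b}, ENNReal.ofReal (g z) := by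
  have hc : ContinuousOn (fun p : ℝ × ℝ => p.1 * g (polarPoint p.1 p.2)) (Icc a b ×ˢ univ) :=
    continuousOn_fst.mul (continuousOn_comp_polarPoint ha.le hg)
  obtain ⟨hi, h1⟩ := integral_integral_eq_setIntegral_prod hab hc
  have hm : MeasurableSet {z : ℂ | ‖z‖ ∈ Ioo a b} := measurable_norm measurableSet_Ioo
  have hae : (Ioc a b ×ˢ Ioc (-Real.pi) Real.pi : Set (ℝ × ℝ)) =ᵐ[volume]
      Ioo a b ×ˢ Ioo (-Real.pi) Real.pi :=
    Measure.set_prod_ae_eq Ioo_ae_eq_Ioc.symm Ioo_ae_eq_Ioc.symm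
  rw [h1, ofReal_integral_eq_lintegral_ofReal hi, setLIntegral_congr hae,
    ← lintegral_indicator hm, ← Complex.lintegral_comp_polarCoord_symm, polarCoord_target]
  · have hsub : (Ioo a b ×ˢ Ioo (-Real.pi) Real.pi : Set (ℝ × ℝ)) ⊆
        Ioi 0 ×ˢ Ioo (-Real.pi) Real.pi :=
      prod_mono (fun x hx => ha.trans hx.1) Subset.rfl
    have hms : MeasurableSet (Ioo a b ×ˢ Ioo (-Real.pi) Real.pi : Set (ℝ × ℝ)) :=
      measurableSet_Ioo.prod measurableSet_Ioo
    rw [← inter_eq_left.2 hsub, ← setLIntegral_indicator hms]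
    refine setLIntegral_congr_fun (measurableSet_Ioi.prod measurableSet_Ioo) fun p hp => ?_
    have hp0 : 0 < p.1 := hp.1
    have hpp : (Complex.polarCoord.symm p : ℂ) = polarPoint p.1 p.2 := by
      rw [Complex.polarCoord_symm_apply, polarPoint, Complex.exp_mul_I]
      push_cast
      rfl
    simp only [hpp]
    by_cases hpa : p.1 ∈ Ioo a b
    · rw [indicator_of_mem (mem_prod.2 ⟨hpa, hp.2⟩),
        indicator_of_mem (by rwa [mem_ofPred_eq, norm_polarPoint hp0.le]),
        ENNReal.ofReal_mul hp0.le, smul_eq_mul]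
    · rw [indicator_of_notMem (fun h => hpa (mem_prod.1 h).1),
        indicator_of_notMem (by rwa [mem_ofPred_eq, norm_polarPoint hp0.le]), smul_zero]
  · refine (ae_restrict_iff' (measurableSet_Ioc.prod measurableSet_Ioc)).2 (.of_forall ?_)
    intro p hp
    refine mul_nonneg (ha.trans hp.1.1).le (hg0 _ ?_)
    rw [norm_polarPoint (ha.trans hp.1.1).le]
    exact Ioc_subset_Icc_self hp.1

end Polar

/-! ### The radial factor of the test function -/

section Radial

/-- `∫ exp (-A x²) / x` over `[r, s]`. -/
noncomputable def radialWeight (A s r : ℝ) : ℝ := ∫ x in r..s, Real.exp (-A * x ^ 2) * x⁻¹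

variable {A s r : ℝ}

theorem continuousOn_radialIntegrand (A : ℝ) :
    ContinuousOn (fun x : ℝ => Real.exp (-A * x ^ 2) * x⁻¹) (Ioi 0) :=
  ContinuousOn.mul (by fun_prop) (continuousOn_inv₀.mono fun _ hx => (ne_of_gt hx))

theorem intervalIntegrable_radialIntegrand (hr : 0 < r) (hs : 0 < s) :
    IntervalIntegrable (fun x : ℝ => Real.exp (-A * x ^ 2) * x⁻¹) volume r s :=
  ((continuousOn_radialIntegrand A).mono fun _ hx =>
    (lt_min hr hs).trans_le hx.1).intervalIntegrable

theorem hasDerivAt_radialWeight (hr : 0 < r) (hs : 0 < s) :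
    HasDerivAt (radialWeight A s) (r⁻¹ * -Real.exp (-A * r ^ 2)) r := by
  have hc := continuousOn_radialIntegrand A
  refine (intervalIntegral.integral_hasDerivAt_left (intervalIntegrable_radialIntegrand hr hs)
    (hc.stronglyMeasurableAtFilter isOpen_Ioi r hr)
    (hc.continuousAt (Ioi_mem_nhds hr))).congr_deriv ?_
  ring

theorem continuousOn_radialWeight (hs : 0 < s) : ContinuousOn (radialWeight A s) (Ioi 0) :=
  fun _ hr => (hasDerivAt_radialWeight hr hs).continuousAt.continuousWithinAt

theorem radialWeight_self : radialWeight A s s = 0 := intervalIntegral.integral_same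

theorem radialWeight_nonneg (hr : 0 < r) (hrs : r ≤ s) : 0 ≤ radialWeight A s r :=
  intervalIntegral.integral_nonneg hrs fun _ hx =>
    mul_nonneg (Real.exp_pos _).le (inv_nonneg.2 (hr.le.trans hx.1))

theorem radialWeight_le_log (hA : 0 ≤ A) (hr : 0 < r) (hrs : r ≤ s) (hs1 : s ≤ 1) :
    radialWeight A s r ≤ -Real.log r := by
  have h0 : (0 : ℝ) ∉ uIcc r s := by
    rw [uIcc_of_le hrs]; exact fun h => absurd h.1 (not_le.2 hr)
  have hs := hr.trans_le hrs
  have : radialWeight A s r ≤ ∫ x in r..s, x⁻¹ := by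
    refine intervalIntegral.integral_mono_on hrs (intervalIntegrable_radialIntegrand hr hs)
      (intervalIntegral.intervalIntegrable_inv (fun _ hx h => h0 (h ▸ hx)) continuousOn_id) ?_
    intro x hx
    refine mul_le_of_le_one_left (inv_nonneg.2 (hr.le.trans hx.1)) (Real.exp_le_one_iff.2 ?_)
    nlinarith [mul_nonneg hA (sq_nonneg x)]
  rw [integral_inv h0, Real.log_div hs.ne' hr.ne'] at this
  linarith [Real.log_nonpos hs.le hs1]

/-- Follows from h ≤ log(1/r) ≤ 1/r - 1. -/
theorem mul_radialWeight_le (hA : 0 ≤ A) (hr : 0 < r) (hrs : r ≤ s) (hs1 : s ≤ 1) :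
    r * radialWeight A s r ≤ 1 - r := by
  have h1 := radialWeight_le_log hA hr hrs hs1
  have h2 := Real.log_le_sub_one_of_pos (inv_pos.2 hr)
  rw [Real.log_inv] at h2
  calc r * radialWeight A s r ≤ r * (r⁻¹ - 1) := by gcongr; linarith
    _ = 1 - r := by field_simp

/-- On (0, 1] the integrand is at least exp(-A). This is the source of the factor 1 - |a| in the
final sum. -/
theorem le_radialWeight (hA : 0 ≤ A) (hr : 0 < r) (hrs : r ≤ s) (hs1 : s ≤ 1) :
    Real.exp (-A) * (s - r) ≤ radialWeight A s r := by
  have h : ∫ _ in r..s, Real.exp (-A) ≤ radialWeight A s r := by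
    refine intervalIntegral.integral_mono_on hrs intervalIntegrable_const
      (intervalIntegrable_radialIntegrand hr (hr.trans_le hrs)) fun x hx => ?_
    have hx0 : 0 < x := hr.trans_le hx.1
    have hx1 : x ≤ 1 := hx.2.trans hs1
    calc Real.exp (-A) = Real.exp (-A) * 1 := (mul_one _).symm
      _ ≤ Real.exp (-A * x ^ 2) * x⁻¹ := by
        gcongr
        · nlinarith [mul_nonneg hA (sub_nonneg.2 (pow_le_one₀ hx0.le hx1 (n := 2)))]
        · exact (one_le_inv₀ hx0).2 hx1
  rw [intervalIntegral.integral_const, smul_eq_mul] at h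
  linarith

theorem hasDerivAt_neg_exp (A r : ℝ) :
    HasDerivAt (fun r => -Real.exp (-A * r ^ 2)) (2 * A * r * Real.exp (-A * r ^ 2)) r := by
  refine (((hasDerivAt_pow 2 r).const_mul (-A)).exp.fun_neg).congr_deriv ?_
  push_cast
  ring

end Radial

/-! ### Concentration of the regularised Laplacians at the zeros -/

section Concentration

open Filter Topology

theorem lintegral_comp_smul_complex {κ : ℝ} (hκ : 0 < κ) (F : ℂ → ℝ≥0∞) :
    ENNReal.ofReal (κ ^ 2) * ∫⁻ z, F (κ * z) = ∫⁻ z, F z := by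
  have h := lintegral_map_equiv (μ := (volume : Measure ℂ)) F
    (Homeomorph.smulOfNeZero κ hκ.ne' : ℂ ≃ₜ ℂ).toMeasurableEquiv
  have hm : Measure.map (Homeomorph.smulOfNeZero κ hκ.ne' : ℂ ≃ₜ ℂ).toMeasurableEquiv
      (volume : Measure ℂ) = ENNReal.ofReal (κ ^ 2)⁻¹ • volume := by
    have := Measure.map_addHaar_smul (volume : Measure ℂ) hκ.ne'
    rw [Complex.finrank_real_complex, abs_of_nonneg (by positivity)] at this
    exact this
  rw [hm, lintegral_smul_measure, smul_eq_mul] at h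
  have h2 : ∫⁻ z, F (κ * z) = ENNReal.ofReal (κ ^ 2)⁻¹ * ∫⁻ z, F z := by
    rw [h]
    refine lintegral_congr fun z => ?_
    simp
  rw [h2, ← mul_assoc, ← ENNReal.ofReal_mul (by positivity), mul_inv_cancel₀ (by positivity),
    ENNReal.ofReal_one, one_mul]

theorem lintegral_comp_add_smul_complex (a : ℂ) {κ : ℝ} (hκ : 0 < κ) (F : ℂ → ℝ≥0∞) :
    ENNReal.ofReal (κ ^ 2) * ∫⁻ z, F (a + κ * z) = ∫⁻ z, F z := by
  rw [lintegral_comp_smul_complex hκ fun z => F (a + z), lintegral_add_left_eq_self]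

theorem lintegral_radial_complex (g : ℝ → ℝ≥0∞) (hg : Measurable g) :
    ∫⁻ z : ℂ, g ‖z‖ =
      ENNReal.ofReal (2 * Real.pi) * ∫⁻ r in Ioi (0 : ℝ), ENNReal.ofReal r * g r := by
  rw [← Complex.lintegral_comp_polarCoord_symm, polarCoord_target, Measure.volume_eq_prod,
    ← Measure.prod_restrict]
  have h : ∀ p : ℝ × ℝ, p ∈ Ioi (0 : ℝ) ×ˢ Ioo (-Real.pi) Real.pi →
      ENNReal.ofReal p.1 • g ‖(Complex.polarCoord.symm p : ℂ)‖ =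
        (ENNReal.ofReal p.1 * g p.1) * 1 := fun p hp => by
    rw [Complex.norm_polarCoord_symm, abs_of_pos hp.1, smul_eq_mul, mul_one]
  rw [Measure.prod_restrict, setLIntegral_congr_fun
    (measurableSet_Ioi.prod measurableSet_Ioo) h, ← Measure.prod_restrict,
    lintegral_prod_mul (f := fun r => ENNReal.ofReal r * g r) (g := fun _ => 1)
      (by fun_prop) (by fun_prop), lintegral_one, Measure.restrict_apply_univ,
    Real.volume_Ioo, mul_comm]
  congr 2
  ring

/-- In polar coordinates the integrand has the primitive `k`, which rises from -(p + 1) at 0 to 0 at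
infinity. The mass therefore does not depend on B. -/
theorem lintegral_bubble (p : ℕ) {B : ℝ} (hB : 0 < B) :
    ∫⁻ z : ℂ, ENNReal.ofReal (2 * (p + 1) ^ 2 * ‖z‖ ^ (2 * p) * B /
      (‖z‖ ^ (2 * p + 2) * B + 1) ^ 2) = ENNReal.ofReal (2 * Real.pi * (p + 1)) := by
  rw [lintegral_radial_complex (fun r => ENNReal.ofReal (2 * (p + 1) ^ 2 * r ^ (2 * p) * B /
      (r ^ (2 * p + 2) * B + 1) ^ 2)) (by fun_prop),
    ENNReal.ofReal_mul (q := (p : ℝ) + 1) (by positivity)]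
  congr 1
  set k : ℝ → ℝ := fun r => -(p + 1) / (r ^ (2 * p + 2) * B + 1)
  set k' : ℝ → ℝ := fun r => r * (2 * (p + 1) ^ 2 * r ^ (2 * p) * B /
      (r ^ (2 * p + 2) * B + 1) ^ 2)
  have hd : ∀ r ∈ Ici (0 : ℝ), HasDerivAt k (k' r) r := by
    intro r hr
    have h0 : r ^ (2 * p + 2) * B + 1 ≠ 0 := by
      have : 0 ≤ r ^ (2 * p + 2) := pow_nonneg hr _
      positivity
    refine ((hasDerivAt_const r (-(p + 1) : ℝ)).fun_div
      (((hasDerivAt_pow (2 * p + 2) r).mul_const B).add_const 1) h0).congr_deriv ?_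
    simp only [k']
    push_cast
    ring
  have hnn : ∀ r ∈ Ioi (0 : ℝ), 0 ≤ k' r := fun r hr => by
    have : 0 < r := hr
    positivity
  have hlim : Tendsto k atTop (𝓝 0) := by
    refine Tendsto.const_div_atTop ?_ _
    refine tendsto_atTop_add_const_right _ _ (Tendsto.atTop_mul_const hB ?_)
    exact tendsto_pow_atTop (by omega)
  have hc : ContinuousWithinAt k (Ici 0) 0 :=
    (hd 0 self_mem_Ici).continuousAt.continuousWithinAt
  have hint := integral_Ioi_of_hasDerivAt_of_nonneg hc
    (fun x hx => hd x (Ioi_subset_Ici_self hx)) hnn hlim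
  have hi := integrableOn_Ioi_deriv_of_nonneg hc
    (fun x hx => hd x (Ioi_subset_Ici_self hx)) hnn hlim
  have h0 : k 0 = -(p + 1) := by simp [k]
  rw [h0, zero_sub, neg_neg] at hint
  refine Eq.trans ?_ (congrArg ENNReal.ofReal hint)
  rw [ofReal_integral_eq_lintegral_ofReal hi
    ((ae_restrict_iff' measurableSet_Ioi).2 (.of_forall hnn))]
  refine setLIntegral_congr_fun measurableSet_Ioi fun r hr => ?_
  rw [← ENNReal.ofReal_mul (le_of_lt hr)]

/-- The Laplacian of `½ log (|f|² + ε)`, for holomorphic `f`. -/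
noncomputable def regLaplacian (f : ℂ → ℂ) (ε : ℝ) (z : ℂ) : ℝ :=
  2 * ε * ‖deriv f z‖ ^ 2 / (‖f z‖ ^ 2 + ε) ^ 2

/-- At distance κ from a zero of order p + 1, |f|² is of order κ^(2p+2) and |f'|² of order κ^(2p).
With ε = κ^(2p+2) all powers of κ cancel after multiplication by the Jacobian κ², and a nontrivial
profile remains. -/
theorem tendsto_rescaled_regLaplacian {f g : ℂ → ℂ} {a : ℂ} {p : ℕ} (hg : AnalyticAt ℂ g a)
    (hfg : ∀ᶠ z in 𝓝 a, f z = (z - a) ^ (p + 1) * g z) {κ : ℕ → ℝ} (hκ : ∀ k, 0 < κ k)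
    (hκ0 : Tendsto κ atTop (𝓝 0)) (ζ : ℂ) :
    Tendsto (fun k => κ k ^ 2 * regLaplacian f (κ k ^ (2 * p + 2)) (a + κ k * ζ)) atTop
      (𝓝 (2 * (p + 1) ^ 2 * ‖ζ‖ ^ (2 * p) * ‖g a‖ ^ 2 /
        (‖ζ‖ ^ (2 * p + 2) * ‖g a‖ ^ 2 + 1) ^ 2)) := by
  have hz : Tendsto (fun k => a + κ k * ζ) atTop (𝓝 a) := by
    have h1 : Tendsto (fun k => ((κ k : ℝ) : ℂ)) atTop (𝓝 ((0 : ℝ) : ℂ)) :=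
      (Complex.continuous_ofReal.tendsto 0).comp hκ0
    simpa using (h1.mul_const ζ).const_add a
  have hda : ∀ᶠ z in 𝓝 a,
      deriv f z = (z - a) ^ p * ((p + 1) * g z + (z - a) * deriv g z) := by
    filter_upwards [hfg.eventually_nhds, hg.eventually_analyticAt] with z h1 h2
    have h3 : f =ᶠ[𝓝 z] fun w => (w - a) ^ (p + 1) * g w := h1
    rw [h3.deriv_eq]
    have h4 := (((hasDerivAt_id z).sub_const a).fun_pow (p + 1)).fun_mul
      h2.differentiableAt.hasDerivAt
    refine h4.deriv.trans ?_
    simp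
    ring
  have hgz : Tendsto (fun k => g (a + κ k * ζ)) atTop (𝓝 (g a)) := hg.continuousAt.tendsto.comp hz
  have hgz' : Tendsto (fun k => deriv g (a + κ k * ζ)) atTop (𝓝 (deriv g a)) :=
    hg.deriv.continuousAt.tendsto.comp hz
  have hsub : Tendsto (fun k => (a + κ k * ζ) - a) atTop (𝓝 0) := by
    simpa using hz.sub_const a
  have hnum : Tendsto (fun k => (p + 1) * g (a + κ k * ζ)
      + ((a + κ k * ζ) - a) * deriv g (a + κ k * ζ)) atTop (𝓝 ((p + 1) * g a)) := by
    simpa using (hgz.const_mul ((p : ℂ) + 1)).add (hsub.mul hgz')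
  have hlim : Tendsto (fun k => 2 * ‖ζ‖ ^ (2 * p) * ‖(p + 1) * g (a + κ k * ζ)
      + ((a + κ k * ζ) - a) * deriv g (a + κ k * ζ)‖ ^ 2 /
        (‖ζ‖ ^ (2 * p + 2) * ‖g (a + κ k * ζ)‖ ^ 2 + 1) ^ 2) atTop
      (𝓝 (2 * ‖ζ‖ ^ (2 * p) * ‖(p + 1) * g a‖ ^ 2 /
        (‖ζ‖ ^ (2 * p + 2) * ‖g a‖ ^ 2 + 1) ^ 2)) := by
    refine Tendsto.div ((hnum.norm.pow 2).const_mul _)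
      ((((hgz.norm.pow 2).const_mul _).add_const 1).pow 2) ?_
    positivity
  have hval : 2 * ‖ζ‖ ^ (2 * p) * ‖(p + 1) * g a‖ ^ 2 /
        (‖ζ‖ ^ (2 * p + 2) * ‖g a‖ ^ 2 + 1) ^ 2 = 2 * (p + 1) ^ 2 * ‖ζ‖ ^ (2 * p) * ‖g a‖ ^ 2 /
        (‖ζ‖ ^ (2 * p + 2) * ‖g a‖ ^ 2 + 1) ^ 2 := by
    have : ‖((p : ℂ) + 1)‖ = p + 1 := by
      rw [← Nat.cast_add_one, Complex.norm_natCast]; simp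
    rw [norm_mul, this]
    ring
  rw [← hval]
  refine hlim.congr' ?_
  filter_upwards [hz.eventually hfg, hz.eventually hda] with k h1 h2
  have hk := hκ k
  rw [regLaplacian, h1, h2]
  simp only [add_sub_cancel_left, norm_mul, norm_pow, Complex.norm_real, Real.norm_of_nonneg hk.le]
  generalize ‖(p + 1) * g (a + κ k * ζ) + κ k * ζ * deriv g (a + κ k * ζ)‖ = X
  generalize ‖g (a + κ k * ζ)‖ = Y
  have e1 : ((κ k * ‖ζ‖) ^ (p + 1) * Y) ^ 2 + κ k ^ (2 * p + 2) =
      κ k ^ (2 * p + 2) * (‖ζ‖ ^ (2 * p + 2) * Y ^ 2 + 1) := by ring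
  rw [e1]
  have e2 : (‖ζ‖ ^ (2 * p + 2) * Y ^ 2 + 1) ≠ 0 := by positivity
  field_simp
  ring

theorem ContinuousOn.measurable_indicator_ofReal {F : ℂ → ℝ} {s : Set ℂ} (hF : ContinuousOn F s)
    (hs : MeasurableSet s) : Measurable (s.indicator fun z => ENNReal.ofReal (F z)) := by
  classical
  have h := ContinuousOn.measurable_piecewise (f := fun z => ENNReal.ofReal (F z))
    (g := fun _ => (0 : ℝ≥0∞)) (ENNReal.continuous_ofReal.comp_continuousOn hF)
    continuousOn_const hs
  rwa [← piecewise_eq_indicator]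

/-- The masses of the Laplacians of `½ log (|f|² + ε)` concentrate at the zeros of `f`. -/
theorem sum_zeros_le_of_lintegral_regLaplacian_le {f : ℂ → ℂ} {A : Set ℂ} (hA : IsOpen A)
    (hf : DifferentiableOn ℂ f A) {ψ : ℂ → ℝ} (hψ : ContinuousOn ψ A) (hψ0 : ∀ z ∈ A, 0 ≤ ψ z)
    {b : ℝ → ℝ≥0∞} {C : ℝ≥0∞} (hb : Tendsto b (𝓝[>] 0) (𝓝 C))
    (hle : ∀ ε > 0, ∫⁻ z in A, ENNReal.ofReal (ψ z * regLaplacian f ε z) ≤ b ε)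
    (Z : Finset ℂ) (hZ : ∀ a ∈ Z, a ∈ A ∧ f a = 0) :
    ∑ a ∈ Z, (analyticOrderNatAt f a : ℝ≥0∞) * ENNReal.ofReal (2 * Real.pi * ψ a) ≤ C := by
  classical
  -- `analyticOrderNatAt` is 0 at points of infinite order, so the filter leaves only zeros of
  -- finite positive order without changing the sum.
  rw [← Finset.sum_filter_of_ne (p := fun a => analyticOrderNatAt f a ≠ 0)
    (fun a _ h h0 => h (by rw [h0]; simp))]
  set Z' := Z.filter fun a => analyticOrderNatAt f a ≠ 0
  have hfa : ∀ a ∈ Z', ∃ (p : ℕ) (g : ℂ → ℂ), analyticOrderNatAt f a = p + 1 ∧ AnalyticAt ℂ g a ∧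
      g a ≠ 0 ∧ ∀ᶠ z in 𝓝 a, f z = (z - a) ^ (p + 1) * g z := by
    intro a ha
    obtain ⟨haZ, h0⟩ := Finset.mem_filter.1 ha
    obtain ⟨p, hp⟩ := Nat.exists_eq_succ_of_ne_zero h0
    have han : AnalyticAt ℂ f a := hf.analyticAt (hA.mem_nhds (hZ a haZ).1)
    have htop : analyticOrderAt f a ≠ ⊤ := fun h => h0 (by rw [analyticOrderNatAt, h]; rfl)
    have hord : analyticOrderAt f a = ((p + 1 : ℕ) : ℕ∞) := by
      rw [← Nat.cast_analyticOrderNatAt htop, hp]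
    obtain ⟨g, hg, hga, hfg⟩ := han.analyticOrderAt_eq_natCast.1 hord
    exact ⟨p, g, hp, hg, hga, by simpa using hfg⟩
  choose! p g hp hg hga hfg using hfa
  -- Disjoint neighbourhoods allow the masses at distinct zeros to be added.
  obtain ⟨U, hU, hdisj⟩ := Z'.finite_toSet.t2_separation
  set E : ℕ → ℝ := fun k => 1 / ((k : ℝ) + 1)
  have hE : ∀ k, 0 < E k := fun k => Nat.one_div_pos_of_nat
  have hE0 : Tendsto E atTop (𝓝 0) := tendsto_one_div_add_atTop_nhds_zero_nat
  -- All zeros share the same ε = `E k`, but each has its own scale, with κ^(2p+2) = ε.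
  set κ : ℂ → ℕ → ℝ := fun a k => E k ^ ((1 : ℝ) / (2 * p a + 2 : ℕ))
  have hκ : ∀ a k, 0 < κ a k := fun a k => Real.rpow_pos_of_pos (hE k) _
  have hκE : ∀ a k, κ a k ^ (2 * p a + 2) = E k := fun a k => by
    simp only [κ]
    rw [one_div, Real.rpow_inv_natCast_pow (hE k).le (by omega)]
  have hκ0 : ∀ a, Tendsto (κ a) atTop (𝓝 0) := fun a => by
    have hpos : (0 : ℝ) < 1 / (2 * p a + 2 : ℕ) := by positivity
    have := hE0.rpow_const (p := (1 : ℝ) / (2 * p a + 2 : ℕ)) (Or.inr hpos.le)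
    rwa [Real.zero_rpow hpos.ne'] at this
  have hcont : ∀ ε > 0, ContinuousOn (fun z => ψ z * regLaplacian f ε z) A := fun ε hε => by
    refine hψ.mul (ContinuousOn.div ?_ ?_ fun z _ => by positivity)
    · exact continuousOn_const.mul ((hf.deriv hA).continuousOn.norm.pow 2)
    · exact ((hf.continuousOn.norm.pow 2).add continuousOn_const).pow 2
  have hUA : ∀ a, IsOpen (U a ∩ A) := fun a => (hU a).2.inter hA
  set F : ℂ → ℕ → ℂ → ℝ≥0∞ := fun a k => (U a ∩ A).indicator
    fun z => ENNReal.ofReal (ψ z * regLaplacian f (E k) z)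
  have hFm : ∀ a k, Measurable (F a k) := fun a k =>
    ((hcont _ (hE k)).mono inter_subset_right).measurable_indicator_ofReal (hUA a).measurableSet
  set G : ℂ → ℕ → ℂ → ℝ≥0∞ := fun a k ζ => ENNReal.ofReal (κ a k ^ 2) * F a k (a + κ a k * ζ)
  have hGm : ∀ a k, Measurable (G a k) := fun a k =>
    ((hFm a k).comp (by fun_prop)).const_mul _
  have hGi : ∀ a k, ∫⁻ ζ, G a k ζ =
      ∫⁻ z in U a ∩ A, ENNReal.ofReal (ψ z * regLaplacian f (E k) z) := fun a k => by
    rw [lintegral_const_mul (f := fun ζ => F a k (a + κ a k * ζ)) _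
        ((hFm a k).comp (by fun_prop)), lintegral_comp_add_smul_complex a (hκ a k), lintegral_indicator (hUA a).measurableSet]
  set ℓ : ℂ → ℂ → ℝ := fun a ζ => 2 * (p a + 1) ^ 2 * ‖ζ‖ ^ (2 * p a) * ‖g a a‖ ^ 2 /
        (‖ζ‖ ^ (2 * p a + 2) * ‖g a a‖ ^ 2 + 1) ^ 2
  have hGlim : ∀ a ∈ Z', ∀ ζ, Tendsto (fun k => G a k ζ) atTop
      (𝓝 (ENNReal.ofReal (ψ a * ℓ a ζ))) := by
    intro a ha ζ
    have haA := (hZ a (Finset.mem_filter.1 ha).1).1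
    have hz : Tendsto (fun k => a + κ a k * ζ) atTop (𝓝 a) := by
      have h1 : Tendsto (fun k => ((κ a k : ℝ) : ℂ)) atTop (𝓝 ((0 : ℝ) : ℂ)) :=
        (Complex.continuous_ofReal.tendsto 0).comp (hκ0 a)
      simpa using (h1.mul_const ζ).const_add a
    have h2 := ((hψ.continuousAt (hA.mem_nhds haA)).tendsto.comp hz).mul
      (tendsto_rescaled_regLaplacian (hg a ha) (hfg a ha) (hκ a) (hκ0 a) ζ)
    refine ((ENNReal.continuous_ofReal.tendsto _).comp h2).congr' ?_
    filter_upwards [hz.eventually ((hUA a).mem_nhds ⟨(hU a).1, haA⟩)] with k hk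
    simp only [G, F, Function.comp, hκE]
    rw [indicator_of_mem (s := U a ∩ A) hk, ← ENNReal.ofReal_mul (by positivity)]
    congr 1
    ring
  have hℓ : ∀ a ∈ Z', ∫⁻ ζ, ENNReal.ofReal (ψ a * ℓ a ζ) =
      (analyticOrderNatAt f a : ℝ≥0∞) * ENNReal.ofReal (2 * Real.pi * ψ a) := by
    intro a ha
    have haA := (hZ a (Finset.mem_filter.1 ha).1).1
    have hB : 0 < ‖g a a‖ ^ 2 := by have := norm_pos_iff.2 (hga a ha); positivity
    simp only [ENNReal.ofReal_mul (hψ0 a haA)]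
    rw [lintegral_const_mul _ (by fun_prop), lintegral_bubble (p a) hB, hp a ha,
      ← ENNReal.ofReal_natCast, ← ENNReal.ofReal_mul (hψ0 a haA),
      ← ENNReal.ofReal_mul (by positivity)]
    congr 1
    push_cast
    ring
  calc ∑ a ∈ Z', (analyticOrderNatAt f a : ℝ≥0∞) * ENNReal.ofReal (2 * Real.pi * ψ a)
      = ∑ a ∈ Z', ∫⁻ ζ, ENNReal.ofReal (ψ a * ℓ a ζ) :=
        Finset.sum_congr rfl fun a ha => (hℓ a ha).symm
    _ = ∫⁻ ζ, ∑ a ∈ Z', ENNReal.ofReal (ψ a * ℓ a ζ) :=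
        (lintegral_finsetSum _ fun a _ => by fun_prop).symm
    _ = ∫⁻ ζ, liminf (fun k => ∑ a ∈ Z', G a k ζ) atTop :=
        lintegral_congr fun ζ => (tendsto_finsetSum _ fun a ha => hGlim a ha ζ).liminf_eq.symm
    -- Fatou's lemma: only this inequality is needed, so no dominating function is required.
    _ ≤ liminf (fun k => ∫⁻ ζ, ∑ a ∈ Z', G a k ζ) atTop :=
        lintegral_liminf_le fun k => Finset.measurable_fun_sum _ fun a _ => hGm a k
    _ ≤ liminf (fun k => b (E k)) atTop := by
        refine liminf_le_liminf (.of_forall fun k => ?_)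
        rw [lintegral_finsetSum _ fun a _ => hGm a k]
        simp only [hGi]
        rw [← lintegral_biUnion_finset (fun a ha c hc hac =>
          (hdisj ha hc hac).mono inter_subset_left inter_subset_left)
          (fun a _ => (hUA a).measurableSet)]
        exact (lintegral_mono_set (iUnion₂_subset fun a _ => inter_subset_right)).trans
          (hle _ (hE k))
    _ = C := (hb.comp (tendsto_nhdsWithin_iff.2 ⟨hE0, .of_forall hE⟩)).liminf_eq

end Concentration

/-! ### Green's formula for the test function, and the sign at the origin -/

section GreenInequality

open Filter Topology

variable {n : ℕ} {η : Fin n → ℂ} {q : Fin n → ℝ} {f : ℂ → ℂ} {ε : ℝ}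

theorem continuousOn_expWeight (hη : ∀ j, ‖η j‖ = 1) :
    ContinuousOn (expWeight η q) (Metric.ball 0 1) :=
  Real.continuous_exp.comp_continuousOn (continuousOn_const.mul
    (Complex.continuous_re.comp_continuousOn (differentiableOn_logWeight hη).continuousOn))

theorem continuousOn_absR (hη : ∀ j, ‖η j‖ = 1) : ContinuousOn (absR η q) (Metric.ball 0 1) :=
  continuousOn_finsetProd _ fun j _ => ContinuousOn.rpow_const (by fun_prop)
    fun _ hz => Or.inl (norm_sub_pos hη j hz).ne'

theorem continuousOn_gammaWeight (hη : ∀ j, ‖η j‖ = 1) :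
    ContinuousOn (gammaWeight η q) (Metric.ball 0 1) :=
  continuousOn_finsetSum _ fun j _ => continuousOn_const.mul
    (ContinuousOn.inv₀ (by fun_prop) fun _ hz => (norm_sub_pos hη j hz).ne')

section Continuity

variable {s : Set ℂ}

theorem continuousOn_regLog (hf : DifferentiableOn ℂ f s) (hε : 0 < ε) : ContinuousOn (regLog f ε) s :=
  (ContinuousOn.log ((hf.continuousOn.norm.pow 2).add continuousOn_const)
    fun z _ => (by positivity : ‖f z‖ ^ 2 + ε ≠ 0)).div_const 2

theorem continuousOn_regLogD (hs : IsOpen s) (hf : DifferentiableOn ℂ f s) (hε : 0 < ε) (c : ℂ) :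
    ContinuousOn (regLogD f ε c) s := by
  have h1 := (hf.eulerDeriv hs).continuousOn
  have h0 := hf.continuousOn
  refine ContinuousOn.div (Complex.continuous_re.comp_continuousOn
    ((Complex.continuous_conj.comp_continuousOn h0).mul (continuousOn_const.mul h1)))
    ((h0.norm.pow 2).add continuousOn_const) fun _ _ => by positivity

theorem continuousOn_regLogDD (hs : IsOpen s) (hf : DifferentiableOn ℂ f s) (hε : 0 < ε) (c : ℂ) :
    ContinuousOn (regLogDD f ε c) s := by
  have h2 := ((hf.eulerDeriv hs).eulerDeriv hs).continuousOn
  have h1 := (hf.eulerDeriv hs).continuousOn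
  have h0 := hf.continuousOn
  have hc := Complex.continuous_conj.comp_continuousOn h0
  have hN : ContinuousOn (fun z => ‖f z‖ ^ 2 + ε) s := (h0.norm.pow 2).add continuousOn_const
  refine ContinuousOn.sub (ContinuousOn.div (ContinuousOn.add ?_ ?_) hN fun _ _ => by positivity)
    (ContinuousOn.div ?_ (hN.pow 2) fun _ _ => by positivity)
  · exact (continuousOn_const.mul h1).norm.pow 2
  · exact Complex.continuous_re.comp_continuousOn (hc.mul (continuousOn_const.mul h2))
  · exact continuousOn_const.mul
      ((Complex.continuous_re.comp_continuousOn (hc.mul (continuousOn_const.mul h1))).pow 2)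

end Continuity

theorem continuousOn_flux (hη : ∀ j, ‖η j‖ = 1) (hf : DifferentiableOn ℂ f (Metric.ball 0 1))
    (hε : 0 < ε) (c : ℂ) {s : Set ℂ} (hs : s ⊆ Metric.ball 0 1) {h h' : ℂ → ℝ}
    (hh : ContinuousOn h s) (hh' : ContinuousOn h' s) :
    ContinuousOn (fun z => flux η q f ε (h z) (h' z) c z) s := by
  have hW := (continuousOn_expWeight (q := q) hη).mono hs
  have hV := (((differentiableOn_logWeight (q := q) hη).eulerDeriv
    Metric.isOpen_ball).continuousOn).mono hs
  have hVr : ContinuousOn (fun z => (c * eulerDeriv (logWeight η q) z).re) s :=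
    Complex.continuous_re.comp_continuousOn (continuousOn_const.mul hV)
  exact ((hh.mul hW).mul ((continuousOn_regLogD Metric.isOpen_ball hf hε c).mono hs)).sub
    (((continuousOn_regLog hf hε).mono hs).mul ((hh'.mul hW).add
      (hh.mul ((continuousOn_const.mul hVr).mul hW))))

theorem continuousOn_fluxD (hη : ∀ j, ‖η j‖ = 1) (hf : DifferentiableOn ℂ f (Metric.ball 0 1))
    (hε : 0 < ε) (c : ℂ) {s : Set ℂ} (hs : s ⊆ Metric.ball 0 1) {h h' h'' : ℂ → ℝ}
    (hh : ContinuousOn h s) (hh' : ContinuousOn h' s) (hh'' : ContinuousOn h'' s) :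
    ContinuousOn (fun z => fluxD η q f ε (h z) (h' z) (h'' z) c z) s := by
  have hW := (continuousOn_expWeight (q := q) hη).mono hs
  have hd := (differentiableOn_logWeight (q := q) hη).eulerDeriv Metric.isOpen_ball
  have hVr : ContinuousOn (fun z => (c * eulerDeriv (logWeight η q) z).re) s :=
    Complex.continuous_re.comp_continuousOn (continuousOn_const.mul (hd.continuousOn.mono hs))
  have hVr' : ContinuousOn (fun z => (c ^ 2 * eulerDeriv (eulerDeriv (logWeight η q)) z).re) s :=
    Complex.continuous_re.comp_continuousOn
      (continuousOn_const.mul ((hd.eulerDeriv Metric.isOpen_ball).continuousOn.mono hs))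
  exact ((hh.mul hW).mul ((continuousOn_regLogDD Metric.isOpen_ball hf hε c).mono hs)).sub
    (((continuousOn_regLog hf hε).mono hs).mul (hW.mul ((hh''.add
      ((continuousOn_const.mul hh').mul hVr)).add (hh.mul ((continuousOn_const.mul hVr').add
        (continuousOn_const.mul (hVr.pow 2)))))))

/-- With m = max(1, |f|) one has |f|² + ε ≤ m²(1 + ε). -/
theorem regLog_le (hε : 0 < ε) (z : ℂ) :
    regLog f ε z ≤ Real.posLog ‖f z‖ + Real.log (1 + ε) / 2 := by
  have hx : 0 ≤ ‖f z‖ := norm_nonneg _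
  set x := ‖f z‖
  have hmax : Real.posLog x = Real.log (max 1 x) := Real.posLog_eq_log_max_one hx
  have h1 : (1 : ℝ) ≤ max 1 x := le_max_left _ _
  have h2 : x ^ 2 ≤ max 1 x ^ 2 := by gcongr; exact le_max_right _ _
  have h3 : x ^ 2 + ε ≤ max 1 x ^ 2 * (1 + ε) := by nlinarith [one_le_pow₀ h1 (n := 2)]
  have h4 := Real.log_le_log (by positivity) h3
  rw [Real.log_mul (by positivity) (by positivity), Real.log_pow] at h4
  rw [regLog, hmax]
  push_cast at h4
  linarith

theorem tendsto_radialWeight_mul_norm {A s : ℝ} (hA : 0 ≤ A) (hs : 0 < s) (hs1 : s ≤ 1) :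
    Tendsto (fun z : ℂ => radialWeight A s ‖z‖ * ‖z‖) (𝓝[≠] 0) (𝓝 0) := by
  have hlog : Tendsto (fun z : ℂ => -(‖z‖ * Real.log ‖z‖)) (𝓝[≠] 0) (𝓝 0) := by
    have : Continuous fun z : ℂ => -(‖z‖ * Real.log ‖z‖) :=
      (Real.continuous_mul_log.comp continuous_norm).neg
    have h := this.tendsto 0
    simp only [norm_zero, zero_mul, neg_zero] at h
    exact h.mono_left nhdsWithin_le_nhds
  have hev : ∀ᶠ z : ℂ in 𝓝[≠] 0, 0 < ‖z‖ ∧ ‖z‖ ≤ s := by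
    filter_upwards [self_mem_nhdsWithin,
      nhdsWithin_le_nhds (Metric.closedBall_mem_nhds (0 : ℂ) hs)] with z h1 h2
    exact ⟨norm_pos_iff.2 h1, mem_closedBall_zero_iff.1 h2⟩
  refine squeeze_zero' ?_ ?_ hlog
  · filter_upwards [hev] with z hz
    exact mul_nonneg (radialWeight_nonneg hz.1 hz.2) hz.1.le
  · filter_upwards [hev] with z hz
    have := mul_le_mul_of_nonneg_right (radialWeight_le_log hA hz.1 hz.2 hs1) hz.1.le
    linarith

/-- The flux equals W(U e + h Re(zB)) with e = exp(-A|z|²) and B continuous at 0. Since |z|h → 0,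
the second term vanishes in the limit, while U(0) = ½ log(1 + ε) is positive. -/
theorem eventually_flux_nonneg (hη : ∀ j, ‖η j‖ = 1)
    (hf : DifferentiableOn ℂ f (Metric.ball 0 1)) (hf0 : ‖f 0‖ = 1) (hε : 0 < ε) {A s : ℝ}
    (hA : 0 ≤ A) (hs : 0 < s) (hs1 : s ≤ 1) :
    ∀ᶠ z in 𝓝[≠] (0 : ℂ),
      0 ≤ flux η q f ε (radialWeight A s ‖z‖) (-Real.exp (-A * ‖z‖ ^ 2)) 1 z := by
  have hmem : Metric.ball (0 : ℂ) 1 ∈ 𝓝 (0 : ℂ) := Metric.ball_mem_nhds _ one_pos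
  have hW := (continuousOn_expWeight (q := q) hη).continuousAt hmem
  have hU := (continuousOn_regLog hf hε).continuousAt hmem
  have hV' := ((differentiableOn_logWeight (q := q) hη).deriv
    Metric.isOpen_ball).continuousOn.continuousAt hmem
  have hf' := (hf.deriv Metric.isOpen_ball).continuousOn.continuousAt hmem
  have hfc := hf.continuousOn.continuousAt hmem
  set B : ℂ → ℂ := fun z => starRingEnd ℂ (f z) * deriv f z / ((‖f z‖ ^ 2 + ε : ℝ) : ℂ)
    - 2 * deriv (logWeight η q) z * (regLog f ε z : ℂ)
  have hB : ContinuousAt B 0 := by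
    refine ContinuousAt.sub (ContinuousAt.div ?_ ?_ ?_) ?_
    · exact (Complex.continuous_conj.continuousAt.comp hfc).mul hf'
    · exact Complex.continuous_ofReal.continuousAt.comp ((hfc.norm.pow 2).add continuousAt_const)
    · exact_mod_cast (by positivity : ‖f 0‖ ^ 2 + ε ≠ 0)
    · exact (continuousAt_const.mul hV').mul (Complex.continuous_ofReal.continuousAt.comp hU)
  have hsmall : Tendsto (fun z => radialWeight A s ‖z‖ * (z * B z).re) (𝓝[≠] 0) (𝓝 0) := by
    have h1 := (tendsto_radialWeight_mul_norm hA hs hs1).mul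
      (hB.norm.tendsto.mono_left (nhdsWithin_le_nhds (s := {0}ᶜ)))
    rw [zero_mul] at h1
    refine squeeze_zero_norm' ?_ h1
    filter_upwards [self_mem_nhdsWithin,
      nhdsWithin_le_nhds (Metric.closedBall_mem_nhds (0 : ℂ) hs)] with z h2 h3
    rw [norm_mul, Real.norm_of_nonneg
      (radialWeight_nonneg (norm_pos_iff.2 h2) (mem_closedBall_zero_iff.1 h3)), mul_assoc]
    refine mul_le_mul_of_nonneg_left ?_
      (radialWeight_nonneg (norm_pos_iff.2 h2) (mem_closedBall_zero_iff.1 h3))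
    rw [← norm_mul]
    exact Complex.abs_re_le_norm _
  have hmain : Tendsto (fun z : ℂ => expWeight η q z *
      (regLog f ε z * Real.exp (-A * ‖z‖ ^ 2) + radialWeight A s ‖z‖ * (z * B z).re)) (𝓝[≠] 0)
      (𝓝 (expWeight η q 0 * (regLog f ε 0 * Real.exp (-A * ‖(0 : ℂ)‖ ^ 2) + 0))) := by
    have hE : Continuous fun z : ℂ => Real.exp (-A * ‖z‖ ^ 2) := by fun_prop
    exact (hW.tendsto.mono_left nhdsWithin_le_nhds).mul
      (((hU.mul hE.continuousAt).tendsto.mono_left nhdsWithin_le_nhds).add hsmall)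
  have hpos : 0 < expWeight η q 0 * (regLog f ε 0 * Real.exp (-A * ‖(0 : ℂ)‖ ^ 2) + 0) := by
    have : 0 < regLog f ε 0 := by
      rw [regLog, hf0]
      have := Real.log_pos (show (1 : ℝ) < 1 ^ 2 + ε by linarith)
      positivity
    have := expWeight_pos η q 0
    positivity
  filter_upwards [hmain.eventually (lt_mem_nhds hpos)] with z hz
  refine hz.le.trans (le_of_eq ?_)
  have hre : (z * B z).re = regLogD f ε 1 z
      - 2 * (eulerDeriv (logWeight η q) z).re * regLog f ε z := by
    have : z * B z = starRingEnd ℂ (f z) * (1 * eulerDeriv f z) / ((‖f z‖ ^ 2 + ε : ℝ) : ℂ)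
        - ((2 * regLog f ε z : ℝ) : ℂ) * eulerDeriv (logWeight η q) z := by
      simp only [B, eulerDeriv]
      push_cast
      ring
    rw [this, Complex.sub_re, Complex.div_ofReal_re, Complex.re_ofReal_mul, regLogD]
    ring
  rw [hre, flux, one_mul]
  ring

/-- Green's formula on the annulus `r < |z| < s` for `½ log (|f|² + ε)` and the test function. -/
theorem integral_testFunction_mul_regLaplacian (hη : ∀ j, ‖η j‖ = 1)
    (hf : DifferentiableOn ℂ f (Metric.ball 0 1)) (hε : 0 < ε) {a s : ℝ} (ha : 0 < a)
    (has : a ≤ s) (hs1 : s < 1) {A : ℝ} (hA : A = 4 * ∑ j, q j) :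
    ∫ r in a..s, ∫ θ in -Real.pi..Real.pi,
      (r * (radialWeight A s ‖polarPoint r θ‖ * expWeight η q (polarPoint r θ)
        * regLaplacian f ε (polarPoint r θ)) -
      r⁻¹ * (regLog f ε (polarPoint r θ) * testLaplacian η q (Real.exp (-A * ‖polarPoint r θ‖ ^ 2))
        (radialWeight A s ‖polarPoint r θ‖) (polarPoint r θ))) =
    (∫ θ in -Real.pi..Real.pi, flux η q f ε (radialWeight A s ‖polarPoint s θ‖)
      (-Real.exp (-A * ‖polarPoint s θ‖ ^ 2)) 1 (polarPoint s θ)) -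
    ∫ θ in -Real.pi..Real.pi, flux η q f ε (radialWeight A s ‖polarPoint a θ‖)
      (-Real.exp (-A * ‖polarPoint a θ‖ ^ 2)) 1 (polarPoint a θ) := by
  have hs : 0 < s := ha.trans_le has
  set K : Set ℂ := {z | ‖z‖ ∈ Icc a s} with hK
  have hKb : K ⊆ Metric.ball 0 1 := fun z hz => mem_ball_zero_iff.2 (hz.2.trans_lt hs1)
  have hpp : ∀ r ∈ Icc a s, ∀ θ, ‖polarPoint r θ‖ = r := fun r hr θ =>
    norm_polarPoint (ha.le.trans hr.1) θ
  have hpb : ∀ r ∈ Icc a s, ∀ θ, polarPoint r θ ∈ Metric.ball (0 : ℂ) 1 := fun r hr θ =>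
    hKb (by rw [hK, mem_ofPred_eq, hpp r hr]; exact hr)
  have hhc : ContinuousOn (fun z : ℂ => radialWeight A s ‖z‖) K :=
    (continuousOn_radialWeight hs).comp continuous_norm.continuousOn fun z hz =>
      ha.trans_le hz.1
  have hec : ContinuousOn (fun z : ℂ => -Real.exp (-A * ‖z‖ ^ 2)) K := by fun_prop
  have hec' : ContinuousOn (fun z : ℂ => 8 * (∑ j, q j) * ‖z‖ ^ 2 * Real.exp (-A * ‖z‖ ^ 2)) K := by
    fun_prop
  have hinv : ContinuousOn (fun p : ℝ × ℝ => p.1⁻¹) (Icc a s ×ˢ univ) :=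
    continuousOn_fst.inv₀ fun p hp => (ha.trans_le hp.1.1).ne'
  -- Since r²Δ = (r∂_r)² + ∂_θ², the radial flux P has ∂_r P = r⁻¹ · (r∂_r)P, and the angular flux
  -- is divided by r. The sum of the two derivatives is then r⁻¹ times the combination of
  -- r²-Laplacians. On circles h is constant, whence the zeros in S and S'.
  have key := integral_divergence_polar has
    (P := fun r θ => flux η q f ε (radialWeight A s r) (-Real.exp (-A * r ^ 2)) 1 (polarPoint r θ))
    (P' := fun r θ => r⁻¹ * fluxD η q f ε (radialWeight A s r) (-Real.exp (-A * r ^ 2))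
      (8 * (∑ j, q j) * r ^ 2 * Real.exp (-A * r ^ 2)) 1 (polarPoint r θ))
    (S := fun r θ => r⁻¹ * flux η q f ε (radialWeight A s r) 0 Complex.I (polarPoint r θ))
    (S' := fun r θ => r⁻¹ * fluxD η q f ε (radialWeight A s r) 0 0 Complex.I (polarPoint r θ))
    ?_ ?_ ?_ ?_ ?_ ?_
  · have hs' := hpp s (right_mem_Icc.2 has)
    have ha' := hpp a (left_mem_Icc.2 has)
    simp only [hs', ha']
    rw [← key]
    refine intervalIntegral.integral_congr fun r hr => intervalIntegral.integral_congr fun θ _ => ?_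
    rw [uIcc_of_le has] at hr
    have hr0 : r ≠ 0 := (ha.trans_le hr.1).ne'
    have hn := hpp r hr θ
    simp only [← mul_add, fluxD_add_fluxD hε hn, hn]
    rw [regLaplacian, eulerDeriv, norm_mul, hn]
    field_simp
  · intro r hr θ
    have hr0 : 0 < r := ha.trans_le hr.1
    refine hasDerivAt_flux hη hε (hasDerivAt_polarPoint_left hr0.ne' θ) (hpb r hr θ) hf
      (hasDerivAt_radialWeight hr0 hs) ((hasDerivAt_neg_exp A r).congr_deriv ?_)
    rw [hA]
    field_simp
    ring
  · intro r hr θ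
    refine ((hasDerivAt_flux (h := fun _ => radialWeight A s r) (h' := fun _ => 0) (h'' := 0) hη hε
      (hasDerivAt_polarPoint_right r θ) (hpb r hr θ) hf ?_ ?_).const_mul r⁻¹).congr_deriv ?_
    · simpa using hasDerivAt_const θ _
    · simpa using hasDerivAt_const θ (0 : ℝ)
    · rw [one_mul]
  · intro r hr
    have h := polarPoint_periodic r (-Real.pi)
    rw [show -Real.pi + 2 * Real.pi = Real.pi by ring] at h
    simp only [h]
  · refine (continuousOn_comp_polarPoint ha.le
      (continuousOn_flux (q := q) hη hf hε 1 hKb hhc hec)).congr fun p hp => ?_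
    simp only [Function.uncurry, hpp p.1 hp.1]
  · refine (hinv.mul (continuousOn_comp_polarPoint ha.le
      (continuousOn_fluxD (q := q) hη hf hε 1 hKb hhc hec hec'))).congr fun p hp => ?_
    simp only [Function.uncurry, Pi.mul_apply, hpp p.1 hp.1]
  · refine (hinv.mul (continuousOn_comp_polarPoint ha.le
      (continuousOn_fluxD (q := q) (h' := fun _ => 0) (h'' := fun _ => 0) hη hf hε Complex.I hKb hhc
        continuousOn_const continuousOn_const))).congr fun p hp => ?_
    simp only [Function.uncurry, Pi.mul_apply, hpp p.1 hp.1]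

end GreenInequality

/-! ### From Green's formula to the sum over the zeros -/

section MainEstimate

open Filter Topology

variable {n : ℕ} {η : Fin n → ℂ} {q : Fin n → ℝ} {f : ℂ → ℂ} {ε : ℝ}

/-- On |z| = s the radial factor vanishes and only U e W survives. The factor 20 + 4Q is generous,
so as to share one constant with the area term. -/
theorem flux_le_of_norm_eq (hη : ∀ j, ‖η j‖ = 1) (hq : ∀ j, 0 ≤ q j) (hε : 0 < ε) {A s : ℝ}
    (hA : 0 ≤ A) (hs1 : s < 1) {z : ℂ} (hz : ‖z‖ = s) :
    flux η q f ε (radialWeight A s ‖z‖) (-Real.exp (-A * ‖z‖ ^ 2)) 1 z ≤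
      (20 + 4 * ∑ j, q j) * Real.exp (2 * ∑ j, q j) *
        (absR η q z ^ 2 * (Real.posLog ‖f z‖ + Real.log (1 + ε) / 2)) := by
  have hzb : z ∈ Metric.ball (0 : ℂ) 1 := mem_ball_zero_iff.2 (hz ▸ hs1)
  have hQ : 0 ≤ ∑ j, q j := Finset.sum_nonneg fun j _ => hq j
  have hM : 0 ≤ Real.posLog ‖f z‖ + Real.log (1 + ε) / 2 := by
    have := Real.log_nonneg (show (1 : ℝ) ≤ 1 + ε by linarith)
    have := Real.posLog_nonneg (x := ‖f z‖)
    positivity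
  have he1 : Real.exp (-A * ‖z‖ ^ 2) ≤ 1 := Real.exp_le_one_iff.2 (by
    nlinarith [mul_nonneg hA (sq_nonneg ‖z‖)])
  have hW := (expWeight_pos η q z).le
  rw [hz, flux, radialWeight_self, ← hz]
  calc _ = regLog f ε z * (Real.exp (-A * ‖z‖ ^ 2) * expWeight η q z) := by ring
    _ ≤ (Real.posLog ‖f z‖ + Real.log (1 + ε) / 2) * (1 * expWeight η q z) :=
      mul_le_mul (regLog_le hε z) (by gcongr) (by positivity) hM
    _ ≤ (Real.posLog ‖f z‖ + Real.log (1 + ε) / 2) *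
        ((20 + 4 * ∑ j, q j) * (Real.exp (2 * ∑ j, q j) * absR η q z ^ 2)) := by
      refine mul_le_mul_of_nonneg_left (mul_le_mul (by linarith) (expWeight_le hη hq hzb) hW
        (by positivity)) hM
    _ = _ := by ring

/-- The sign of the Laplacian is essential: U can be very negative near zeros of f, and only an
upper bound for it is available. -/
theorem regLog_mul_testLaplacian_le (hη : ∀ j, ‖η j‖ = 1) (hq : ∀ j, 0 ≤ q j) (hε : 0 < ε)
    {A s : ℝ} (hA : 0 ≤ A) (hs1 : s < 1) {z : ℂ} (hz0 : 0 < ‖z‖) (hzs : ‖z‖ ≤ s) :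
    regLog f ε z *
      testLaplacian η q (Real.exp (-A * ‖z‖ ^ 2)) (radialWeight A s ‖z‖) z ≤
      ‖z‖ ^ 2 * ((20 + 4 * ∑ j, q j) * Real.exp (2 * ∑ j, q j) *
        (gammaWeight η q z * absR η q z ^ 2 * (Real.posLog ‖f z‖ + Real.log (1 + ε) / 2))) := by
  have hzb : z ∈ Metric.ball (0 : ℂ) 1 := mem_ball_zero_iff.2 (hzs.trans_lt hs1)
  have hQ : 0 ≤ ∑ j, q j := Finset.sum_nonneg fun j _ => hq j
  have hM : 0 ≤ Real.posLog ‖f z‖ + Real.log (1 + ε) / 2 := by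
    have := Real.log_nonneg (show (1 : ℝ) ≤ 1 + ε by linarith)
    have := Real.posLog_nonneg (x := ‖f z‖)
    positivity
  have he0 := (Real.exp_pos (-A * ‖z‖ ^ 2)).le
  have he1 : Real.exp (-A * ‖z‖ ^ 2) ≤ 1 := Real.exp_le_one_iff.2 (by
    nlinarith [mul_nonneg hA (sq_nonneg ‖z‖)])
  have hh := radialWeight_nonneg (A := A) hz0 hzs
  have hγ := gammaWeight_nonneg (η := η) (q := q) z
  calc _ ≤ (Real.posLog ‖f z‖ + Real.log (1 + ε) / 2) *
        testLaplacian η q (Real.exp (-A * ‖z‖ ^ 2)) (radialWeight A s ‖z‖) z :=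
      mul_le_mul_of_nonneg_right (regLog_le hε z) (testLaplacian_nonneg hη hq hzb he0 hh)
    _ ≤ (Real.posLog ‖f z‖ + Real.log (1 + ε) / 2) * ((20 + 4 * ∑ j, q j) *
        expWeight η q z * (‖z‖ ^ 2 * gammaWeight η q z)) :=
      mul_le_mul_of_nonneg_left (testLaplacian_le hη hq hzb he0 he1 hh
        (mul_radialWeight_le hA hz0 hzs hs1.le)) hM
    _ ≤ (Real.posLog ‖f z‖ + Real.log (1 + ε) / 2) * ((20 + 4 * ∑ j, q j) *
        (Real.exp (2 * ∑ j, q j) * absR η q z ^ 2) * (‖z‖ ^ 2 * gammaWeight η q z)) := by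
      gcongr
      exact expWeight_le hη hq hzb
    _ = _ := by ring

theorem ofReal_integral_circle {G : ℂ → ℝ} {s : ℝ} (hs : 0 ≤ s)
    (hG : ContinuousOn G {z | ‖z‖ ∈ Icc s s}) (hG0 : ∀ z, 0 ≤ G z) :
    ENNReal.ofReal (∫ θ in -Real.pi..Real.pi, G (polarPoint s θ)) =
      ∫⁻ θ in Ioc (0 : ℝ) (2 * Real.pi), ENNReal.ofReal (G (polarPoint s θ)) := by
  have hc : Continuous fun θ => G (polarPoint s θ) :=
    continuousOn_univ.1 ((continuousOn_comp_polarPoint hs hG).comp (f := fun θ => (s, θ))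
      (by fun_prop) fun θ _ => ⟨left_mem_Icc.2 le_rfl, mem_univ _⟩)
  have hper : Function.Periodic (fun θ => G (polarPoint s θ)) (2 * Real.pi) := fun θ => by
    simp only [polarPoint_periodic s θ]
  have h := hper.intervalIntegral_add_eq (-Real.pi) 0
  rw [show -Real.pi + 2 * Real.pi = Real.pi by ring, zero_add] at h
  rw [h, intervalIntegral.integral_of_le (by positivity),
    ofReal_integral_eq_lintegral_ofReal ((hc.integrableOn_Icc).mono_set Ioc_subset_Icc_self)
      (.of_forall fun θ => hG0 _)]

theorem lintegral_annulus_regLaplacian_le (hη : ∀ j, ‖η j‖ = 1) (hq : ∀ j, 0 ≤ q j)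
    (hf : DifferentiableOn ℂ f (Metric.ball 0 1)) (hf0 : ‖f 0‖ = 1) (hε : 0 < ε) {a s : ℝ}
    (ha : 0 < a) (has : a < s) (hs1 : s < 1) {A : ℝ} (hA : A = 4 * ∑ j, q j) :
    ∫⁻ z in {z : ℂ | ‖z‖ ∈ Ioo a s},
      ENNReal.ofReal (radialWeight A s ‖z‖ * expWeight η q z * regLaplacian f ε z) ≤
    ENNReal.ofReal ((20 + 4 * ∑ j, q j) * Real.exp (2 * ∑ j, q j)) *
      ((∫⁻ θ in Ioc (0 : ℝ) (2 * Real.pi), ENNReal.ofReal (absR η q (polarPoint s θ) ^ 2 *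
          (Real.posLog ‖f (polarPoint s θ)‖ + Real.log (1 + ε) / 2))) +
        ∫⁻ z in Metric.ball (0 : ℂ) s, ENNReal.ofReal (gammaWeight η q z * absR η q z ^ 2 *
          (Real.posLog ‖f z‖ + Real.log (1 + ε) / 2))) := by
  have hQ : 0 ≤ ∑ j, q j := Finset.sum_nonneg fun j _ => hq j
  have hA0 : 0 ≤ A := by rw [hA]; positivity
  have hs : 0 < s := ha.trans has
  have hpi : -Real.pi ≤ Real.pi := by linarith [Real.pi_pos]
  set K := (20 + 4 * ∑ j, q j) * Real.exp (2 * ∑ j, q j) with hKdef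
  have hK : 0 ≤ K := by positivity
  set M : ℂ → ℝ := fun z => Real.posLog ‖f z‖ + Real.log (1 + ε) / 2 with hMdef
  have hM : ∀ z, 0 ≤ M z := fun z => by
    have := Real.log_nonneg (show (1 : ℝ) ≤ 1 + ε by linarith)
    have := Real.posLog_nonneg (x := ‖f z‖)
    positivity
  set u : ℂ → ℝ := fun z => K * (absR η q z ^ 2 * M z)
  set v : ℂ → ℝ := fun z => K * (gammaWeight η q z * absR η q z ^ 2 * M z)
  have hu0 : ∀ z, 0 ≤ u z := fun z => mul_nonneg hK (mul_nonneg (sq_nonneg _) (hM z))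
  have hv0 : ∀ z, 0 ≤ v z := fun z => mul_nonneg hK
    (mul_nonneg (mul_nonneg (gammaWeight_nonneg z) (sq_nonneg _)) (hM z))
  obtain ⟨ρ, hρ, hρ'⟩ := Metric.mem_nhdsWithin_iff.1
    (eventually_flux_nonneg (q := q) hη hf hf0 hε hA0 hs hs1.le)
  -- The inner radius is shrunk until the flux through its circle is nonnegative; enlarging the
  -- annulus only increases the integral of a nonnegative function.
  set b := min a (ρ / 2)
  have hb : 0 < b := lt_min ha (by positivity)
  have hba : b ≤ a := min_le_left _ _
  have hbs : b ≤ s := hba.trans has.le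
  have hbρ : b < ρ := (min_le_right _ _).trans_lt (by linarith)
  set R : Set ℂ := {z | ‖z‖ ∈ Icc b s} with hR
  have hRb : R ⊆ Metric.ball 0 1 := fun z hz => mem_ball_zero_iff.2 (hz.2.trans_lt hs1)
  have hMc : ContinuousOn M (Metric.ball 0 1) :=
    (Real.continuous_posLog.comp_continuousOn hf.continuousOn.norm).add continuousOn_const
  have huc : ContinuousOn u (Metric.ball 0 1) :=
    continuousOn_const.mul (((continuousOn_absR hη).pow 2).mul hMc)
  have hvc : ContinuousOn v (Metric.ball 0 1) :=
    continuousOn_const.mul (((continuousOn_gammaWeight hη).mul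
      ((continuousOn_absR hη).pow 2)).mul hMc)
  have hhc : ContinuousOn (fun z : ℂ => radialWeight A s ‖z‖) R :=
    (continuousOn_radialWeight hs).comp continuous_norm.continuousOn fun z hz =>
      hb.trans_le hz.1
  have hec : ContinuousOn (fun z : ℂ => Real.exp (-A * ‖z‖ ^ 2)) R := by fun_prop
  set g : ℂ → ℝ := fun z => radialWeight A s ‖z‖ * expWeight η q z * regLaplacian f ε z
  set T : ℂ → ℝ := fun z => regLog f ε z *
    testLaplacian η q (Real.exp (-A * ‖z‖ ^ 2)) (radialWeight A s ‖z‖) z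
  have hg0 : ∀ z, ‖z‖ ∈ Icc b s → 0 ≤ g z := fun z hz => by
    have h1 := radialWeight_nonneg (A := A) (hb.trans_le hz.1) hz.2
    have h2 := expWeight_pos η q z
    have h3 : 0 ≤ regLaplacian f ε z := by rw [regLaplacian]; positivity
    positivity
  have hgc : ContinuousOn g R := by
    refine (hhc.mul ((continuousOn_expWeight hη).mono hRb)).mul
      (ContinuousOn.div ?_ ?_ fun z _ => (by positivity : (‖f z‖ ^ 2 + ε) ^ 2 ≠ 0))
    · exact continuousOn_const.mul
        (((hf.deriv Metric.isOpen_ball).continuousOn.mono hRb).norm.pow 2)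
    · exact (((hf.continuousOn.mono hRb).norm.pow 2).add continuousOn_const).pow 2
  have hTc : ContinuousOn T R := by
    have hV := (((differentiableOn_logWeight (q := q) hη).eulerDeriv
      Metric.isOpen_ball).continuousOn).mono hRb
    refine ((continuousOn_regLog hf hε).mono hRb).mul
      (((continuousOn_expWeight hη).mono hRb).mul (ContinuousOn.add (ContinuousOn.sub ?_ ?_) ?_))
    · exact (continuousOn_const.mul (by fun_prop)).mul hec
    · exact (continuousOn_const.mul hec).mul (Complex.continuous_re.comp_continuousOn hV)
    · exact (continuousOn_const.mul hhc).mul (hV.norm.pow 2)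
  have hp1 : ∀ {w : ℂ → ℝ}, ContinuousOn w R → ContinuousOn
      (fun p : ℝ × ℝ => p.1 * w (polarPoint p.1 p.2)) (Icc b s ×ˢ univ) := fun hw =>
    continuousOn_fst.mul (continuousOn_comp_polarPoint hb.le hw)
  have hp2 : ContinuousOn (fun p : ℝ × ℝ => p.1⁻¹ * T (polarPoint p.1 p.2)) (Icc b s ×ˢ univ) :=
    (continuousOn_fst.inv₀ fun p hp => (hb.trans_le hp.1.1).ne').mul
      (continuousOn_comp_polarPoint hb.le hTc)
  obtain ⟨ig, eg⟩ := integral_integral_eq_setIntegral_prod hbs (hp1 hgc)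
  obtain ⟨iv, ev⟩ := integral_integral_eq_setIntegral_prod hbs (hp1 (hvc.mono hRb))
  obtain ⟨id, ed⟩ := integral_integral_eq_setIntegral_prod hbs ((hp1 hgc).fun_sub hp2)
  have hgreen := integral_testFunction_mul_regLaplacian (q := q) hη hf hε hb hbs hs1 hA
  -- Pointwise r⁻¹T ≤ r v, so adding the integral of r v compensates for the subtracted term.
  have hle1 : ∫ r in b..s, ∫ θ in -Real.pi..Real.pi, r * g (polarPoint r θ) ≤
      (∫ r in b..s, ∫ θ in -Real.pi..Real.pi, r * v (polarPoint r θ)) +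
      ∫ r in b..s, ∫ θ in -Real.pi..Real.pi,
        (r * g (polarPoint r θ) - r⁻¹ * T (polarPoint r θ)) := by
    rw [eg, ev, ed, ← integral_add iv id]
    refine setIntegral_mono_on ig (iv.add id) (measurableSet_Ioc.prod measurableSet_Ioc) ?_
    intro p hp
    have hp0 : 0 < p.1 := hb.trans hp.1.1
    have hn := norm_polarPoint hp0.le p.2
    have h := regLog_mul_testLaplacian_le (f := f) hη hq hε hA0 hs1
      (z := polarPoint p.1 p.2) (by rw [hn]; exact hp0) (by rw [hn]; exact hp.1.2)
    have h2 : p.1⁻¹ * T (polarPoint p.1 p.2) ≤ p.1 * v (polarPoint p.1 p.2) := by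
      calc _ ≤ p.1⁻¹ * (‖polarPoint p.1 p.2‖ ^ 2 * v (polarPoint p.1 p.2)) :=
            mul_le_mul_of_nonneg_left h (inv_nonneg.2 hp0.le)
        _ = _ := by rw [hn]; field_simp
    change p.1 * g (polarPoint p.1 p.2) ≤ p.1 * v (polarPoint p.1 p.2) +
      (p.1 * g (polarPoint p.1 p.2) - p.1⁻¹ * T (polarPoint p.1 p.2))
    linarith
  have hle2 : ∫ r in b..s, ∫ θ in -Real.pi..Real.pi,
        (r * g (polarPoint r θ) - r⁻¹ * T (polarPoint r θ)) ≤
      ∫ θ in -Real.pi..Real.pi, u (polarPoint s θ) := by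
    rw [hgreen]
    have hpos : 0 ≤ ∫ θ in -Real.pi..Real.pi, flux η q f ε (radialWeight A s ‖polarPoint b θ‖)
        (-Real.exp (-A * ‖polarPoint b θ‖ ^ 2)) 1 (polarPoint b θ) := by
      refine intervalIntegral.integral_nonneg hpi fun θ _ => hρ' ?_
      have hn := norm_polarPoint hb.le θ
      exact ⟨mem_ball_zero_iff.2 (hn.trans_lt hbρ), norm_pos_iff.1 (hn.symm ▸ hb)⟩
    have hcirc : ∀ {w : ℂ → ℝ}, ContinuousOn w R → Continuous fun θ => w (polarPoint s θ) :=
      fun hw => continuousOn_univ.1 ((continuousOn_comp_polarPoint hb.le hw).comp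
        (f := fun θ => (s, θ)) (by fun_prop) fun θ _ => ⟨right_mem_Icc.2 hbs, mem_univ _⟩)
    have hmono : ∫ θ in -Real.pi..Real.pi, flux η q f ε (radialWeight A s ‖polarPoint s θ‖)
        (-Real.exp (-A * ‖polarPoint s θ‖ ^ 2)) 1 (polarPoint s θ) ≤
        ∫ θ in -Real.pi..Real.pi, u (polarPoint s θ) :=
      intervalIntegral.integral_mono_on hpi
        ((hcirc (continuousOn_flux hη hf hε 1 hRb hhc hec.neg)).intervalIntegrable _ _)
        ((hcirc (huc.mono hRb)).intervalIntegrable _ _)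
        fun θ _ => flux_le_of_norm_eq hη hq hε hA0 hs1 (norm_polarPoint hs.le θ)
    linarith
  have hcs : {z : ℂ | ‖z‖ ∈ Icc s s} ⊆ Metric.ball 0 1 := fun z hz =>
    mem_ball_zero_iff.2 (hz.2.trans_lt hs1)
  calc ∫⁻ z in {z : ℂ | ‖z‖ ∈ Ioo a s}, ENNReal.ofReal (g z)
      ≤ ∫⁻ z in {z : ℂ | ‖z‖ ∈ Ioo b s}, ENNReal.ofReal (g z) :=
        lintegral_mono_set fun z hz => ⟨hba.trans_lt hz.1, hz.2⟩
    _ = ENNReal.ofReal (∫ r in b..s, ∫ θ in -Real.pi..Real.pi, r * g (polarPoint r θ)) :=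
        (ofReal_integral_polar hb hbs hgc hg0).symm
    _ ≤ ENNReal.ofReal (∫ θ in -Real.pi..Real.pi, u (polarPoint s θ)) +
        ENNReal.ofReal (∫ r in b..s, ∫ θ in -Real.pi..Real.pi, r * v (polarPoint r θ)) :=
        (ENNReal.ofReal_le_ofReal (by linarith)).trans ENNReal.ofReal_add_le
    _ = (∫⁻ θ in Ioc (0 : ℝ) (2 * Real.pi), ENNReal.ofReal (u (polarPoint s θ))) +
        ∫⁻ z in {z : ℂ | ‖z‖ ∈ Ioo b s}, ENNReal.ofReal (v z) := by
        rw [ofReal_integral_circle hs.le (huc.mono hcs) hu0,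
          ofReal_integral_polar hb hbs (hvc.mono hRb) fun z _ => hv0 z]
    _ ≤ (∫⁻ θ in Ioc (0 : ℝ) (2 * Real.pi), ENNReal.ofReal (u (polarPoint s θ))) +
        ∫⁻ z in Metric.ball (0 : ℂ) s, ENNReal.ofReal (v z) := by
        gcongr
        exact fun z hz => mem_ball_zero_iff.2 hz.2
    _ = _ := by
        simp only [u, v, ENNReal.ofReal_mul hK]
        rw [lintegral_const_mul' _ _ ENNReal.ofReal_ne_top,
          lintegral_const_mul' _ _ ENNReal.ofReal_ne_top, mul_add]

theorem sum_zeros_annulus_le (hη : ∀ j, ‖η j‖ = 1) (hq : ∀ j, 0 ≤ q j)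
    (hf : DifferentiableOn ℂ f (Metric.ball 0 1)) (hf0 : ‖f 0‖ = 1) {a s : ℝ}
    (ha : 0 < a) (has : a < s) (hs1 : s < 1) {A : ℝ} (hA : A = 4 * ∑ j, q j)
    (Z : Finset ℂ) (hZ : ∀ z ∈ Z, ‖z‖ ∈ Ioo a s ∧ f z = 0) :
    ∑ z ∈ Z, (analyticOrderNatAt f z : ℝ≥0∞) *
      ENNReal.ofReal (2 * Real.pi * (radialWeight A s ‖z‖ * expWeight η q z)) ≤
    ENNReal.ofReal ((20 + 4 * ∑ j, q j) * Real.exp (2 * ∑ j, q j)) *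
      ((∫⁻ θ in Ioc (0 : ℝ) (2 * Real.pi), ENNReal.ofReal (absR η q (polarPoint s θ) ^ 2 *
          Real.posLog ‖f (polarPoint s θ)‖)) +
        ∫⁻ z in Metric.ball (0 : ℂ) s, ENNReal.ofReal (gammaWeight η q z * absR η q z ^ 2 *
          Real.posLog ‖f z‖)) := by
  have hs : 0 < s := ha.trans has
  set K := (20 + 4 * ∑ j, q j) * Real.exp (2 * ∑ j, q j)
  set R : Set ℂ := {z | ‖z‖ ∈ Ioo a s}
  have hRo : IsOpen R := isOpen_Ioo.preimage continuous_norm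
  have hRb : R ⊆ Metric.ball 0 1 := fun z hz => mem_ball_zero_iff.2 (hz.2.trans hs1)
  have hhc : ContinuousOn (fun z : ℂ => radialWeight A s ‖z‖) R :=
    (continuousOn_radialWeight hs).comp continuous_norm.continuousOn fun z hz => ha.trans hz.1
  set I := (∫⁻ θ in Ioc (0 : ℝ) (2 * Real.pi), ENNReal.ofReal (absR η q (polarPoint s θ) ^ 2 *
          Real.posLog ‖f (polarPoint s θ)‖)) +
        ∫⁻ z in Metric.ball (0 : ℂ) s, ENNReal.ofReal (gammaWeight η q z * absR η q z ^ 2 *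
          Real.posLog ‖f z‖)
  set J := (∫⁻ θ in Ioc (0 : ℝ) (2 * Real.pi), ENNReal.ofReal (absR η q (polarPoint s θ) ^ 2)) +
        ∫⁻ z in Metric.ball (0 : ℂ) s, ENNReal.ofReal (gammaWeight η q z * absR η q z ^ 2)
  have hcirc : Continuous fun θ => absR η q (polarPoint s θ) ^ 2 := by
    have hcb : {z : ℂ | ‖z‖ ∈ Icc s s} ⊆ Metric.ball 0 1 := fun z hz =>
      mem_ball_zero_iff.2 (hz.2.trans_lt hs1)
    exact continuousOn_univ.1 ((continuousOn_comp_polarPoint hs.le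
      (((continuousOn_absR hη).pow 2).mono hcb)).comp (f := fun θ => (s, θ)) (by fun_prop)
        fun θ _ => ⟨left_mem_Icc.2 le_rfl, mem_univ _⟩)
  have hball : Metric.closedBall (0 : ℂ) s ⊆ Metric.ball 0 1 := Metric.closedBall_subset_ball hs1
  have hγw : ContinuousOn (fun z => gammaWeight η q z * absR η q z ^ 2) (Metric.ball 0 1) :=
    (continuousOn_gammaWeight hη).mul ((continuousOn_absR hη).pow 2)
  have hJ : J ≠ ∞ := by
    refine ENNReal.add_ne_top.2 ⟨?_, ?_⟩
    · exact ((hcirc.integrableOn_Icc (a := 0) (b := 2 * Real.pi)).mono_set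
        Ioc_subset_Icc_self).lintegral_lt_top.ne
    · exact (((hγw.mono hball).integrableOn_compact (isCompact_closedBall 0 s)).mono_set
        Metric.ball_subset_closedBall).lintegral_lt_top.ne
  -- The bound is affine in log(1 + ε)/2 with slope a multiple of `J`. As s < 1 the weights are
  -- bounded on the closed disc of radius s, so `J` is finite and the extra term disappears as ε →
  -- 0.
  set b : ℝ → ℝ≥0∞ := fun ε =>
    ENNReal.ofReal K * (I + ENNReal.ofReal (Real.log (1 + ε) / 2) * J)
  have hb : Tendsto b (𝓝[>] 0) (𝓝 (ENNReal.ofReal K * I)) := by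
    have h1 : Tendsto (fun ε : ℝ => Real.log (1 + ε) / 2) (𝓝[>] 0) (𝓝 0) := by
      have : ContinuousAt (fun ε : ℝ => Real.log (1 + ε) / 2) 0 :=
        (ContinuousAt.log (by fun_prop) (by norm_num)).div_const 2
      have h := this.tendsto
      simp only [add_zero, Real.log_one, zero_div] at h
      exact h.mono_left nhdsWithin_le_nhds
    have h2 := ENNReal.tendsto_ofReal h1
    rw [ENNReal.ofReal_zero] at h2
    have h3 := (ENNReal.Tendsto.mul_const h2 (Or.inr hJ)).const_add I
    rw [zero_mul, add_zero] at h3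
    exact ENNReal.Tendsto.const_mul h3 (Or.inr ENNReal.ofReal_ne_top)
  refine sum_zeros_le_of_lintegral_regLaplacian_le hRo (hf.mono hRb)
    (ψ := fun z => radialWeight A s ‖z‖ * expWeight η q z)
    (hhc.mul ((continuousOn_expWeight hη).mono hRb))
    (fun z hz => mul_nonneg (radialWeight_nonneg (ha.trans hz.1) hz.2.le)
      (expWeight_pos η q z).le) hb (fun ε hε => ?_) Z hZ
  refine (lintegral_annulus_regLaplacian_le hη hq hf hf0 hε ha has hs1 hA).trans ?_
  refine mul_le_mul_right (le_of_eq ?_) _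
  have hlog : 0 ≤ Real.log (1 + ε) / 2 := by
    have := Real.log_nonneg (show (1 : ℝ) ≤ 1 + ε by linarith)
    positivity
  have hpt : ∀ {x y : ℝ}, 0 ≤ x → 0 ≤ y → ENNReal.ofReal (x * (y + Real.log (1 + ε) / 2)) =
      ENNReal.ofReal (x * y) + ENNReal.ofReal (Real.log (1 + ε) / 2) * ENNReal.ofReal x := by
    intro x y hx hy
    rw [← ENNReal.ofReal_mul hlog, ← ENNReal.ofReal_add (by positivity) (by positivity)]
    congr 1
    ring
  have hmball : Measurable ((Metric.ball (0 : ℂ) s).indicator fun z =>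
      ENNReal.ofReal (gammaWeight η q z * absR η q z ^ 2)) :=
    (hγw.mono (Metric.ball_subset_closedBall.trans hball)).measurable_indicator_ofReal
      measurableSet_ball
  have e1 : ∫⁻ θ in Ioc (0 : ℝ) (2 * Real.pi), ENNReal.ofReal (absR η q (polarPoint s θ) ^ 2 *
      (Real.posLog ‖f (polarPoint s θ)‖ + Real.log (1 + ε) / 2)) =
      (∫⁻ θ in Ioc (0 : ℝ) (2 * Real.pi), ENNReal.ofReal (absR η q (polarPoint s θ) ^ 2 *
          Real.posLog ‖f (polarPoint s θ)‖)) + ENNReal.ofReal (Real.log (1 + ε) / 2) *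
      ∫⁻ θ in Ioc (0 : ℝ) (2 * Real.pi), ENNReal.ofReal (absR η q (polarPoint s θ) ^ 2) := by
    simp only [fun θ => hpt (sq_nonneg (absR η q (polarPoint s θ)))
      (Real.posLog_nonneg (x := ‖f (polarPoint s θ)‖))]
    rw [lintegral_add_right _ (hcirc.measurable.ennreal_ofReal.const_mul _),
      lintegral_const_mul' _ _ ENNReal.ofReal_ne_top]
  have e2 : ∫⁻ z in Metric.ball (0 : ℂ) s, ENNReal.ofReal (gammaWeight η q z * absR η q z ^ 2 *
      (Real.posLog ‖f z‖ + Real.log (1 + ε) / 2)) =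
      (∫⁻ z in Metric.ball (0 : ℂ) s, ENNReal.ofReal (gammaWeight η q z * absR η q z ^ 2 *
          Real.posLog ‖f z‖)) + ENNReal.ofReal (Real.log (1 + ε) / 2) *
      ∫⁻ z in Metric.ball (0 : ℂ) s, ENNReal.ofReal (gammaWeight η q z * absR η q z ^ 2) := by
    simp only [fun z => hpt (mul_nonneg (gammaWeight_nonneg (η := η) (q := q) z)
      (sq_nonneg (absR η q z))) (Real.posLog_nonneg (x := ‖f z‖))]
    rw [lintegral_add_right', lintegral_const_mul' _ _ ENNReal.ofReal_ne_top]
    exact ((aemeasurable_indicator_iff measurableSet_ball).1 hmball.aemeasurable).const_mul _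
  rw [e1, e2]
  ring

theorem sum_zeros_le_nevanlinnaNorm (hη : ∀ j, ‖η j‖ = 1) (hq : ∀ j, 0 ≤ q j)
    (hf : DifferentiableOn ℂ f (Metric.ball 0 1)) (hf0 : ‖f 0‖ = 1) {δ : ℝ}
    (hδ : δ ∈ Ioo (0 : ℝ) 1) (Z : Finset ℂ) (hZ : ∀ z ∈ Z, z ∈ discZeros f) :
    ∑ z ∈ Z, (analyticOrderNatAt f z : ℝ≥0∞) * ENNReal.ofReal ((1 - ‖z‖ ^ 2) * absR η q z ^ 2) ≤
    ENNReal.ofReal (Real.exp (6 * ∑ j, q j) *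
      ((20 + 4 * ∑ j, q j) * Real.exp (2 * ∑ j, q j))) * nevanlinnaNorm η q δ f := by
  have hQ : 0 ≤ ∑ j, q j := Finset.sum_nonneg fun j _ => hq j
  set K := (20 + 4 * ∑ j, q j) * Real.exp (2 * ∑ j, q j)
  set N := nevanlinnaNorm η q δ f with hN
  have hZ0 : ∀ z ∈ Z, 0 < ‖z‖ := fun z hz => norm_pos_iff.2 fun h => by
    have := (hZ z hz).2
    rw [h] at this
    rw [this] at hf0
    simp at hf0
  -- Since |f(0)| = 1, a finite set of zeros avoids a disc about 0.
  obtain ⟨a, ha, haZ⟩ : ∃ a > 0, ∀ z ∈ Z, a < ‖z‖ := by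
    have : ∀ᶠ a in 𝓝[>] (0 : ℝ), ∀ z ∈ Z, a < ‖z‖ :=
      (Finset.eventually_all Z).2 fun z hz => nhdsWithin_le_nhds (Iio_mem_nhds (hZ0 z hz))
    obtain ⟨a, h1, h2⟩ := (this.and self_mem_nhdsWithin).exists
    exact ⟨a, h2, h1⟩
  have hev : ∀ᶠ s in 𝓝[<] (1 : ℝ), ∑ z ∈ Z, (analyticOrderNatAt f z : ℝ≥0∞) *
      ENNReal.ofReal ((s - ‖z‖) * (1 + ‖z‖) * absR η q z ^ 2) ≤
      ENNReal.ofReal (Real.exp (6 * ∑ j, q j) * K) * N := by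
    have hevZ : ∀ᶠ s in 𝓝[<] (1 : ℝ), ∀ z ∈ Z, ‖z‖ < s :=
      (Finset.eventually_all Z).2 fun z hz =>
        nhdsWithin_le_nhds (Ioi_mem_nhds (mem_ball_zero_iff.1 (hZ z hz).1))
    filter_upwards [hevZ, Ioo_mem_nhdsLT (show 1 - δ < 1 by linarith [hδ.1]), self_mem_nhdsWithin]
      with s hsZ hsδ hs1
    have hs1 : s < 1 := hs1
    have hs : 0 < s := by linarith [hsδ.1, hδ.2]
    have hlow : ∀ z ∈ Z, ENNReal.ofReal ((s - ‖z‖) * (1 + ‖z‖) * absR η q z ^ 2) ≤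
        ENNReal.ofReal (Real.exp (6 * ∑ j, q j)) * ENNReal.ofReal (2 * Real.pi *
          (radialWeight (4 * ∑ j, q j) s ‖z‖ * expWeight η q z)) := by
      intro z hz
      rw [← ENNReal.ofReal_mul (Real.exp_pos _).le]
      refine ENNReal.ofReal_le_ofReal ?_
      have hz1 := mem_ball_zero_iff.1 (hZ z hz).1
      have hsz : 0 ≤ s - ‖z‖ := by linarith [hsZ z hz]
      have h1 := le_radialWeight (A := 4 * ∑ j, q j) (by positivity) (hZ0 z hz) (hsZ z hz).le hs1.le
      have h2 := absR_sq_le hη hq (hZ z hz).1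
      have h3 : s - ‖z‖ ≤ Real.exp (4 * ∑ j, q j) * radialWeight (4 * ∑ j, q j) s ‖z‖ := by
        calc s - ‖z‖ = Real.exp (4 * ∑ j, q j) * (Real.exp (-(4 * ∑ j, q j)) * (s - ‖z‖)) := by
              rw [← mul_assoc, ← Real.exp_add, add_neg_cancel, Real.exp_zero, one_mul]
          _ ≤ _ := by gcongr
      have hr := radialWeight_nonneg (A := 4 * ∑ j, q j) (hZ0 z hz) (hsZ z hz).le
      have hW := expWeight_pos η q z
      have hexp : Real.exp (6 * ∑ j, q j) =
          Real.exp (4 * ∑ j, q j) * Real.exp (2 * ∑ j, q j) := by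
        rw [← Real.exp_add]; congr 1; ring
      -- The factor exp(4Q) comes from the lower bound for h, exp(2Q) from comparing |R|² with W,
      -- and 1 + |z| ≤ 2π.
      calc (s - ‖z‖) * (1 + ‖z‖) * absR η q z ^ 2
          ≤ (Real.exp (4 * ∑ j, q j) * radialWeight (4 * ∑ j, q j) s ‖z‖) * (2 * Real.pi) *
            (Real.exp (2 * ∑ j, q j) * expWeight η q z) := by
              gcongr
              linarith [Real.pi_gt_three]
        _ = _ := by rw [hexp]; ring
    have hmain := sum_zeros_annulus_le hη hq hf hf0 (a := min a (s / 2)) (s := s)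
      (lt_min ha (by positivity)) ((min_le_right _ _).trans_lt (by linarith)) hs1 rfl Z
      fun z hz => ⟨⟨(min_le_left _ _).trans_lt (haZ z hz), hsZ z hz⟩, (hZ z hz).2⟩
    -- The substitution z ↦ sz has Jacobian s² ≤ 1, which can be discarded.
    have hscale : ∫⁻ z in Metric.ball (0 : ℂ) s, ENNReal.ofReal (gammaWeight η q z *
        absR η q z ^ 2 * Real.posLog ‖f z‖) ≤ ∫⁻ z in Metric.ball (0 : ℂ) 1,
        ENNReal.ofReal (gammaWeight η q (s * z) * absR η q (s * z) ^ 2 *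
          Real.posLog ‖f (s * z)‖) := by
      rw [← lintegral_indicator measurableSet_ball, ← lintegral_indicator measurableSet_ball,
        ← lintegral_comp_smul_complex hs]
      refine (mul_le_of_le_one_left zero_le ?_).trans (lintegral_mono fun z => ?_)
      · rw [ENNReal.ofReal_le_one]
        exact pow_le_one₀ hs.le hs1.le
      · by_cases hz : z ∈ Metric.ball (0 : ℂ) 1
        · rw [indicator_of_mem hz]
          exact indicator_le_self _ _ _
        · rw [indicator_of_notMem]
          · exact zero_le
          · rw [mem_ball_zero_iff, norm_mul, Complex.norm_real, Real.norm_of_nonneg hs.le]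
            rw [mem_ball_zero_iff] at hz
            intro h
            exact hz (by nlinarith)
    calc _ ≤ ∑ z ∈ Z, (analyticOrderNatAt f z : ℝ≥0∞) *
          (ENNReal.ofReal (Real.exp (6 * ∑ j, q j)) * ENNReal.ofReal (2 * Real.pi *
          (radialWeight (4 * ∑ j, q j) s ‖z‖ * expWeight η q z))) :=
          Finset.sum_le_sum fun z hz => mul_le_mul_right (hlow z hz) _
      _ = ENNReal.ofReal (Real.exp (6 * ∑ j, q j)) * ∑ z ∈ Z, (analyticOrderNatAt f z : ℝ≥0∞) *
          ENNReal.ofReal (2 * Real.pi *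
          (radialWeight (4 * ∑ j, q j) s ‖z‖ * expWeight η q z)) := by
          refine Eq.trans ?_ (Finset.mul_sum _ _ _).symm
          exact Finset.sum_congr rfl fun z _ => mul_left_comm _ _ _
      _ ≤ ENNReal.ofReal (Real.exp (6 * ∑ j, q j)) * (ENNReal.ofReal K * N) := by
          refine mul_le_mul_right (hmain.trans (mul_le_mul_right ?_ _)) _
          rw [hN, nevanlinnaNorm]
          refine add_le_add ?_ (hscale.trans ?_)
          · exact le_iSup₂_of_le s hsδ le_rfl
          · exact le_iSup₂_of_le s hsδ le_rfl
      _ = _ := by rw [ENNReal.ofReal_mul (Real.exp_pos _).le, mul_assoc]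
  -- The right-hand side does not depend on s, so s → 1 turns (s - |z|)(1 + |z|) into 1 - |z|².
  refine le_of_tendsto ?_ hev
  refine tendsto_finsetSum _ fun z _ => ENNReal.Tendsto.const_mul (ENNReal.tendsto_ofReal ?_)
    (Or.inr (ENNReal.natCast_ne_top _))
  have hc : Continuous fun s : ℝ => (s - ‖z‖) * (1 + ‖z‖) * absR η q z ^ 2 := by fun_prop
  have h := hc.tendsto 1
  rw [show (1 - ‖z‖) * (1 + ‖z‖) * absR η q z ^ 2 = (1 - ‖z‖ ^ 2) * absR η q z ^ 2 by ring] at h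
  exact h.mono_left nhdsWithin_le_nhds

end MainEstimate

theorem mainTheorem3 (n : ℕ) (η : Fin n → ℂ) (hη : ∀ j, ‖η j‖ = 1)
    (q : Fin n → ℝ) (hq : ∀ j, 0 ≤ q j) :
    ∃ c : ℝ≥0, 0 < c ∧ ∀ f ∈ nevanlinnaClass η q, ‖f 0‖ = 1 →
      ∀ δ ∈ Ioo (0 : ℝ) 1, blaschkeSum η q f ≤ c * nevanlinnaNorm η q δ f := by
  have hQ : 0 ≤ ∑ j, q j := Finset.sum_nonneg fun j _ => hq j
  refine ⟨Real.toNNReal (Real.exp (6 * ∑ j, q j) *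
    ((20 + 4 * ∑ j, q j) * Real.exp (2 * ∑ j, q j))), Real.toNNReal_pos.2 (by positivity), ?_⟩
  intro f hf hf0 δ hδ
  -- A sum in [0, ∞] is the supremum of its finite partial sums, so finite sets of zeros suffice.
  rw [blaschkeSum, ENNReal.tsum_eq_iSup_sum]
  refine iSup_le fun T => ?_
  have h := sum_zeros_le_nevanlinnaNorm hη hq hf.1 hf0 hδ (T.map (Function.Embedding.subtype _))
    fun z hz => by
      obtain ⟨w, _, rfl⟩ := Finset.mem_map.1 hz
      exact w.2
  rw [Finset.sum_map] at h
  exact h
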